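/- Setting. Consider the Gaussian linear model $y=X\beta+\varepsilon$ with fixed design $X\in\mathbb R^{n\times d}$ of full column rank and $\varepsilon_i$ i.i.d. $\mathcal N(0,\sigma^2)$, $\sigma>0$. Let $\Sigma=(X^{\mathsf T}X)^{-1}$, let $\widehat\beta=\Sigma X^{\mathsf T}y$, and let $d_1=\#\{j:\beta_j\neq 0\}$. A *knockoff procedure at level $\alpha$* is one of the following. (i) *Whitening formulation.* Choose a diagonal $\Delta\succeq\Sigma$ and noise $\omega\sim\mathcal N_d(0,\sigma^2(\Delta-\Sigma))$ independent of $\widehat\beta$. Put $\widetilde\beta=\widehat\beta+\omega$ and $\xi=\Sigma^{-1}\widehat\beta-\Delta^{-1}\widetilde\beta$. Choose an ordering $[1],\dots,[d]$ of the hypotheses $H_j:\beta_j=0$ and directions $\psi_j\in\{\pm1\}$, both arbitrary measurable functions of $(\xi,|\widetilde\beta|)$. Set $\widetilde p_j=1/2$ if $\mathrm{sgn}(\widetilde\beta_j)=\psi_j$ and $\widetilde p_j=1$ otherwise. Reject $H_{[j]}$ if $j\le\hat k$ and $\widetilde p_{[j]}=1/2$, where $\hat k$ is the largest $k\le d$ with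 $$\frac{1+\#\{j\le k:\widetilde p_{[j]}=1\}}{\#\{j\le k:\widetilde p_{[j]}=1/2\}}\le\alpha ,$$ and reject nothing if there is no such $k$. (ii) *Standard formulation.* Choose $\widetilde X\in\mathbb R^{n\times d}$ with $\widetilde X^{\mathsf T}\widetilde X=X^{\mathsf T}X$ and $\widetilde X^{\mathsf T}X=X^{\mathsf T}X-D$, where $D$ is diagonal with positive diagonal entries, and measurable statistics $W_1,\dots,W_d$ of $y$ such that each $\mathrm{sgn}((X_j-\widetilde X_j)^{\mathsf T}y)\,W_j$ depends on $y$ only through the unordered pairs $\{X_l^{\mathsf T}y,\widetilde X_l^{\mathsf T}y\}$, $l=1,\dots,d$. Reject $\{j:W_j\ge\hat t\}$, where $\hat t$ is the smallest $t\in\{|W_1|,\dots,|W_d|\}\setminus\{0\}$ with $(1+\#\{j:W_j\le-t\})/\#\{j:W_j\ge t\}\le\alpha$, and reject nothing if there is no such $t$. In this case put $\Delta=2D^{-1}$, $\widetilde\beta=D^{-1}(X-\widetilde X)^{\mathsf T}y$ and $\xi=\Sigma^{-1}\widehat\beta-\Delta^{-1}\widetilde\beta$. Let $R$ be the number of rejections.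 Let $\mathrm{TPR}$ be the expectation of the number of rejected $j$ with $\beta_j\ne0$ divided by $d_1$. Let $\eta_j=\frac{2|\widetilde\beta_j|}{\sigma^2\Delta_{jj}}|\beta_j|$, with order statistics $\eta_{(1)}\ge\dots\ge\eta_{(d)}$, and $\eta_{(k)}=0$ for $k>d$. Claim. (a) For all $\alpha>0$ and $\delta>0$ there are constants $c_1,c_2$ depending only on $\alpha$ and $\delta$ such that, for every such model, every knockoff procedure at level $\alpha$ and every $1\le k\le d$, almost surely on the event $\{\eta_{(k)}<-\log(\alpha+\delta)\}$, $$\mathbb E\big[R\,\big|\,\xi,|\widetilde\beta|\big]\le c_1k+c_2 .$$ (b) If moreover $k\ge1/\alpha$, then almost surely on the same event $\mathbb E[R\mid\xi,|\widetilde\beta|]\le C_1(\alpha,\delta)\,k+C_2(\alpha,\delta)$, where, with $p=\frac{\alpha}{1+\alpha}$, $q_\delta=\frac{\alpha+\delta}{1+\alpha+\delta}$, $\lambda^*=p+\frac{q_\delta-p}{4}$ and $c_h=-\big[\lambda^*\log\frac{q_\delta}{\lambda^*}+(1-\lambda^*)\log\frac{1-q_\delta}{1-\lambda^*}\big]$,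 $$C_1(\alpha,\delta)=\frac1{1+\alpha}\Big[\max\Big\{1,\frac{4\alpha(1+\alpha+\delta)}{\delta}\Big\}+1\Big],$$ $$C_2(\alpha,\delta)=\frac1{1+\alpha}\Big[\frac{e}{4\sqrt\pi}\,\frac{\sqrt{1+\alpha}\,q_\delta}{\sqrt{p(1-p)}}\,c_h^{-3/2}\min\Big\{\frac{2(q_\delta-p)}{p(1-q_\delta)},1\Big\}+2\Big].$$ (c) Fix $\alpha\in(0,1)$ and consider any sequence of such models with one knockoff procedure at level $\alpha$ for each. If $d_1\to\infty$ and $\eta_{(\lceil cd_1\rceil)}\to0$ in probability for every $c>0$, then $\mathrm{TPR}\to0$. -/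

import Mathlib

open MeasureTheory ProbabilityTheory Filter Topology
open scoped ENNReal Matrix

noncomputable section

namespace Knockoff

variable {Ω : Type*} [MeasurableSpace Ω] {n d : ℕ}

/-! ### The Gaussian linear model -/

/-- The fixed-design Gaussian linear model `y = X β + ε` with i.i.d. errors `ε i ∼ N(0, σ²)`,
`σ > 0`, and a design matrix of full column rank. -/
structure IsGaussianLinearModel (μ : Measure Ω) (X : Matrix (Fin n) (Fin d) ℝ) (β : Fin d → ℝ)
    (σ : ℝ) (y : Ω → Fin n → ℝ) : Prop where
  sigma_pos : 0 < σ
  full_column_rank : LinearIndependent ℝ (fun j => X.col j)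
  measurable_response : Measurable y
  indep_errors : iIndepFun (fun i ω => y ω i - (X *ᵥ β) i) μ
  law_errors : ∀ i, HasLaw (fun ω => y ω i - (X *ᵥ β) i) (gaussianReal 0 ⟨σ ^ 2, sq_nonneg σ⟩) μ

/-- `Σ = (Xᵀ X)⁻¹`. -/
def olsCov (X : Matrix (Fin n) (Fin d) ℝ) : Matrix (Fin d) (Fin d) ℝ := (Xᵀ * X)⁻¹

/-- The ordinary least squares estimator `(Xᵀ X)⁻¹ Xᵀ y`. -/
def ols (X : Matrix (Fin n) (Fin d) ℝ) (y : Fin n → ℝ) : Fin d → ℝ := olsCov X *ᵥ (Xᵀ *ᵥ y)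

/-- `ξ = Σ⁻¹ βhat - Δ⁻¹ βt`, where `βt` is the whitened estimator and `Δ` is given by its
diagonal. -/
def xi (X : Matrix (Fin n) (Fin d) ℝ) (Δ : Fin d → ℝ) (y : Fin n → ℝ) (βt : Fin d → ℝ) :
    Fin d → ℝ :=
  (olsCov X)⁻¹ *ᵥ ols X y - (Matrix.diagonal Δ)⁻¹ *ᵥ βt

/-- What the analyst may see in the exploratory stage: the pair `(ξ, |βt|)`. -/
def exploratoryData (X : Matrix (Fin n) (Fin d) ℝ) (Δ : Fin d → ℝ) (y : Ω → Fin n → ℝ)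
    (βt : Ω → Fin d → ℝ) (ω : Ω) : (Fin d → ℝ) × (Fin d → ℝ) :=
  (xi X Δ (y ω) (βt ω), fun j => |βt ω j|)

/-- The σ-algebra generated by `(ξ, |βt|)`. -/
abbrev exploratorySigma (X : Matrix (Fin n) (Fin d) ℝ) (Δ : Fin d → ℝ) (y : Ω → Fin n → ℝ)
    (βt : Ω → Fin d → ℝ) : MeasurableSpace Ω :=
  MeasurableSpace.comap (exploratoryData X Δ y βt) inferInstance

/-- The conditional log-odds `η j = 2 |βt j| |β j| / (σ² Δ j)`. -/
def eta (β : Fin d → ℝ) (σ : ℝ) (Δ : Fin d → ℝ) (βt : Fin d → ℝ) (j : Fin d) : ℝ :=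
  2 * |βt j| / (σ ^ 2 * Δ j) * |β j|

/-- The `k`-th largest entry `x_(k)` of a vector, `1 ≤ k ≤ d`; it is `0` for other `k`. -/
def kthLargest (x : Fin d → ℝ) (k : ℕ) : ℝ :=
  if h : 1 ≤ k ∧ k ≤ d then x (Tuple.sort (fun j => -x j) ⟨k - 1, by omega⟩) else 0

/-! ### Selective SeqStep on binary p-values, and the whitening method -/

open Classical in
/-- The FDP estimate after the first `k` hypotheses in the order `ord 0, ord 1, …`, that is
`(1 + #{p = 1}) / #{p = 1/2}` (infinite if the denominator vanishes). -/
def fdpWh (p : Fin d → ℝ) (ord : Equiv.Perm (Fin d)) (k : ℕ) : ℝ≥0∞ :=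
  (1 + (Finset.univ.filter (fun i : Fin d => (i : ℕ) < k ∧ p (ord i) = 1)).card) /
    (Finset.univ.filter (fun i : Fin d => (i : ℕ) < k ∧ p (ord i) = 1 / 2)).card

open Classical in
/-- `khat`, the largest `k ≤ d` with FDP estimate at most `α` (`0` if there is none). -/
def kHat (p : Fin d → ℝ) (ord : Equiv.Perm (Fin d)) (α : ℝ) : ℕ :=
  ((Finset.range (d + 1)).filter (fun k => fdpWh p ord k ≤ ENNReal.ofReal α)).sup id

open Classical in
/-- Selective SeqStep rejects those of the first `khat` hypotheses that have `p = 1/2`. -/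
def seqStep (p : Fin d → ℝ) (ord : Equiv.Perm (Fin d)) (α : ℝ) : Finset (Fin d) :=
  Finset.univ.filter (fun j => (ord.symm j : ℕ) < kHat p ord α ∧ p j = 1 / 2)

/-- The conditional p-values: `1/2` if `sgn (βt j)` is the selected direction `ψ j`, else `1`. -/
def pValue (βt ψ : Fin d → ℝ) (j : Fin d) : ℝ := if Real.sign (βt j) = ψ j then 1 / 2 else 1

/-- A recipe for the exploratory stage: an ordering of the hypotheses and directions `ψ j = ±1`,
both arbitrary (measurable) functions of `(ξ, |βt|)`. -/
structure Recipe (d : ℕ) where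
  order : (Fin d → ℝ) × (Fin d → ℝ) → Equiv.Perm (Fin d)
  direction : (Fin d → ℝ) × (Fin d → ℝ) → Fin d → ℝ
  measurableSet_order : ∀ π, MeasurableSet {v | order v = π}
  measurable_direction : Measurable direction
  direction_eq : ∀ v j, direction v j = 1 ∨ direction v j = -1

/-! ### The knockoff+ filter on W-statistics -/

open Classical in
/-- The FDP estimate `(1 + #{W j ≤ -t}) / #{W j ≥ t}` at the threshold `t`. -/
def fdpKn (W : Fin d → ℝ) (t : ℝ) : ℝ≥0∞ :=
  (1 + (Finset.univ.filter (fun j => W j ≤ -t)).card) /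
    (Finset.univ.filter (fun j => t ≤ W j)).card

open Classical in
/-- The candidate thresholds `t ∈ {|W j|} \ {0}` with FDP estimate at most `α`. -/
def thresholds (W : Fin d → ℝ) (α : ℝ) : Finset ℝ :=
  (Finset.univ.image (fun j => |W j|)).filter (fun t => 0 < t ∧ fdpKn W t ≤ ENNReal.ofReal α)

open Classical in
/-- The knockoff+ filter rejects `{j | W j ≥ that}` with `that` the least admissible threshold
(`∞` if there is none). -/
def knockoffFilter (W : Fin d → ℝ) (α : ℝ) : Finset (Fin d) :=
  Finset.univ.filter (fun j => (thresholds W α).min ≤ (W j : WithTop ℝ))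

/-- The unordered pair property: `sgn((X j - Xt j)ᵀ y) * W j` depends on `y` only through the
unordered pairs `{X jᵀ y, Xt jᵀ y}`. For a knockoff matrix `Xt`, every statistic with the
sufficiency and antisymmetry properties has it. -/
def UnorderedPairProperty (X Xt : Matrix (Fin n) (Fin d) ℝ) (W : (Fin n → ℝ) → Fin d → ℝ) : Prop :=
  ∀ y y' : Fin n → ℝ,
    (∀ j, s((Xᵀ *ᵥ y) j, (Xtᵀ *ᵥ y) j) = s((Xᵀ *ᵥ y') j, (Xtᵀ *ᵥ y') j)) →
    ∀ j, Real.sign (((X - Xt)ᵀ *ᵥ y) j) * W y j = Real.sign (((X - Xt)ᵀ *ᵥ y') j) * W y' j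

/-! ### Knockoff procedures -/

/-- `IsKnockoffProcedure μ X σ α y Δ βt R`: the random set `R` is the rejection set of a fixed-X
knockoff procedure at level `α`, in either of its two formulations, for the response `y`; `βt` is
its whitened estimator and `Δ` (given by its diagonal) the whitened covariance.
* `whitening`: user noise `w ∼ N(0, σ² (Δ - Σ))`, independent of the OLS estimator, any diagonal
  `Δ ⪰ Σ`, and any exploratory recipe.
* `standard`: any knockoff matrix `Xt` with `Xᵀ Xt = Xᵀ X - D`, `D` diagonal with positive
  entries, and any W-statistics with the unordered pair property; here `Δ = 2 D⁻¹` and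
  `βt = D⁻¹ (X - Xt)ᵀ y`. -/
inductive IsKnockoffProcedure (μ : Measure Ω) (X : Matrix (Fin n) (Fin d) ℝ) (σ α : ℝ)
    (y : Ω → Fin n → ℝ) : (Fin d → ℝ) → (Ω → Fin d → ℝ) → (Ω → Finset (Fin d)) → Prop
  | whitening (Δ : Fin d → ℝ) (w : Ω → Fin d → ℝ) (A : Recipe d)
      (dominates : (Matrix.diagonal Δ - olsCov X).PosSemidef)
      (measurable_noise : Measurable w)
      (law_noise : HasLaw (fun ω => WithLp.toLp 2 (w ω))
        (multivariateGaussian 0 (σ ^ 2 • (Matrix.diagonal Δ - olsCov X))) μ)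
      (indep_noise : IndepFun w (fun ω => ols X (y ω)) μ)
      (βt : Ω → Fin d → ℝ) (whitened : βt = fun ω => ols X (y ω) + w ω)
      (R : Ω → Finset (Fin d))
      (rejections : R = fun ω =>
        seqStep (pValue (βt ω) (A.direction (exploratoryData X Δ y βt ω)))
          (A.order (exploratoryData X Δ y βt ω)) α) :
      IsKnockoffProcedure μ X σ α y Δ βt R
  | standard (Xt : Matrix (Fin n) (Fin d) ℝ) (D : Fin d → ℝ) (W : (Fin n → ℝ) → Fin d → ℝ)
      (pos : ∀ j, 0 < D j)
      (gram : Xtᵀ * Xt = Xᵀ * X)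
      (cross : Xtᵀ * X = Xᵀ * X - Matrix.diagonal D)
      (measurable_stat : Measurable W)
      (pairs : UnorderedPairProperty X Xt W)
      (βt : Ω → Fin d → ℝ) (whitened : βt = fun ω j => (D j)⁻¹ * ((X - Xt)ᵀ *ᵥ y ω) j)
      (R : Ω → Finset (Fin d))
      (rejections : R = fun ω => knockoffFilter (W (y ω)) α) :
      IsKnockoffProcedure μ X σ α y (fun j => 2 / D j) βt R

open Classical in
/-- `d₁`, the number of nonzero coefficients. -/
def numNonnull (β : Fin d → ℝ) : ℕ := (Finset.univ.filter (fun j => β j ≠ 0)).card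

open Classical in
/-- The true positive rate: the expected fraction of non-nulls that are rejected. -/
def tpr (μ : Measure Ω) (β : Fin d → ℝ) (R : Ω → Finset (Fin d)) : ℝ :=
  ∫ ω, (((R ω).filter (fun j => β j ≠ 0)).card : ℝ) / (numNonnull β : ℝ) ∂μ

/-! ### The explicit constants -/

/-- `p = α / (1 + α)`. -/
def pOf (α : ℝ) : ℝ := α / (1 + α)

/-- `q_δ = (α + δ) / (1 + α + δ)`. -/
def qOf (α δ : ℝ) : ℝ := (α + δ) / (1 + α + δ)

/-- `λ* = p + (q_δ - p) / 4`. -/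
def lamOf (α δ : ℝ) : ℝ := pOf α + (qOf α δ - pOf α) / 4

/-- `c_h = -[λ* log (q_δ / λ*) + (1 - λ*) log ((1 - q_δ) / (1 - λ*))]`. -/
def chOf (α δ : ℝ) : ℝ :=
  -(lamOf α δ * Real.log (qOf α δ / lamOf α δ) +
    (1 - lamOf α δ) * Real.log ((1 - qOf α δ) / (1 - lamOf α δ)))

/-- The explicit slope `C₁(α, δ)`. -/
def C₁ (α δ : ℝ) : ℝ := 1 / (1 + α) * (max 1 (4 * α * (1 + α + δ) / δ) + 1)

/-- The explicit intercept `C₂(α, δ)`. -/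
def C₂ (α δ : ℝ) : ℝ :=
  1 / (1 + α) *
    (Real.exp 1 / (4 * √Real.pi) * (√(1 + α) * qOf α δ / √(pOf α * (1 - pOf α))) *
      chOf α δ ^ (-(3 / 2) : ℝ) *
      min (2 * (qOf α δ - pOf α) / (pOf α * (1 - qOf α δ))) 1 + 2)

end Knockoff

end

open scoped NNReal

noncomputable section

namespace Knockoff

/-! ### A maximal inequality for multiplicative binary walks -/

/-! Both formulations reduce to one statement about independent signs. The whitened estimator has
independent `N(β j, σ² Δ j)` entries and is independent of `ξ`, because the relevant covariances
vanish. Hence, given `(ξ, |βt|)`, its signs are independent with log-odds `± η j`. Once these data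
are fixed, the order and the directions are deterministic, and the rejections are the matches inside
an initial segment in which mismatches plus one are at most `α` times matches (`IsSequential`,
`exists_selection`).

Fewer than `k` indices have `η j ≥ -log (α + δ)`; at every other index a match has probability at
most `1 - q`, with `q = q_δ > p = α / (1 + α)`. A rejection set of size `r` needs a segment with
mismatch fraction about `p` or less, which is unlikely once the segment is much longer than `k`.

To bound the mean of `r`, take the likelihood ratio of mismatch probability `λ*` against `q`, with
factor one at the exceptional indices. It is a nonnegative supermartingale, and its logarithm at the
rejection time is at least the Kullback–Leibler divergence `c_h` times the segment length, up to a
multiple of `k`. The rejection time anticipates the future, so optional stopping is not available. A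
maximal inequality replaces it: by Ville's inequality, `P(sup M ≥ t) ≤ 1 / t`, and integrating `dt /
t` over `t ≥ 1` shows that the positive part of the running maximum of `log M` has mean at most one
(`sum_log_max_le`). This gives a bound linear in `k` with intercept of order `1 / c_h`
(`IsSequential.sum_card_le`).

Comparing this with the stated constants is calculus (`inv_chOf_le`, `bound_le_explicit`). The same
constants serve for (a) and (b). For (c), integrate the bound over the event where it applies, with
`k` equal to the ceiling of `c d₁` and `c` small. -/

/-- If the factors `f i` have weighted mean at most one, the logarithm of the walk
`x * ∏ i < l, f i (s i)`, stopped at an arbitrary (even anticipating) time and truncated below at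
`y`, has mean at most `log y + x / y`. -/
theorem sum_log_max_le {n : ℕ} (w f : Fin n → Bool → ℝ) (hw : ∀ i t, 0 ≤ w i t)
    (hw1 : ∀ i, w i true + w i false = 1) (hf : ∀ i t, 0 < f i t)
    (hwf : ∀ i, w i true * f i true + w i false * f i false ≤ 1)
    (l : (Fin n → Bool) → ℕ) (x y : ℝ) (hx : 0 < x) (hxy : x ≤ y) :
    ∑ s : Fin n → Bool, (∏ i, w i (s i)) *
      Real.log (max y (x * ∏ i : Fin n, if (i : ℕ) < l s then f i (s i) else 1))
        ≤ Real.log y + x / y := by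
  induction n generalizing x y with
  | zero =>
    have : 0 ≤ x / y := div_nonneg hx.le (hx.le.trans hxy)
    simp [max_eq_left hxy, this]
  | succ n ih =>
    have hy : 0 < y := hx.trans_le hxy
    have step : ∀ t : Bool, ∑ s : Fin n → Bool, (∏ i : Fin n, w i.succ (s i)) *
        Real.log (max y (x * ∏ i : Fin (n + 1),
          if (i : ℕ) < l (Fin.cons t s) then f i ((Fin.cons t s : Fin (n + 1) → Bool) i) else 1))
        ≤ Real.log y + x * f 0 t / y := by
      intro t
      have hxt : 0 < x * f 0 t := mul_pos hx (hf 0 t)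
      -- The floor is raised to the current value when that value exceeds it. The floor therefore
      -- records the running maximum, and this is why an anticipating time does no harm.
      have h1 := ih (fun i => w i.succ) (fun i => f i.succ) (fun i => hw _) (fun i => hw1 _)
        (fun i => hf _) (fun i => hwf _) (fun s => l (Fin.cons t s) - 1) (x * f 0 t)
        (max y (x * f 0 t)) hxt (le_max_right _ _)
      refine (Finset.sum_le_sum fun s _ => ?_).trans (h1.trans ?_)
      · refine mul_le_mul_of_nonneg_left ?_ (Finset.prod_nonneg fun i _ => hw _ _)
        refine Real.log_le_log (lt_max_of_lt_left hy) ?_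
        refine max_le ((le_max_left _ _).trans (le_max_left _ _)) ?_
        rw [Fin.prod_univ_succ]
        -- For stopping time zero the product is empty and the floor `y ≥ x` covers the value;
        -- otherwise one step has been used up.
        rcases Nat.eq_zero_or_pos (l (Fin.cons t s)) with h0 | h0
        · simp [h0, hxy]
        · refine le_max_of_le_right (le_of_eq ?_)
          have : ∀ i : Fin n, ((i.succ : Fin (n + 1)) : ℕ) < l (Fin.cons t s) ↔
              (i : ℕ) < l (Fin.cons t s) - 1 := fun i => by
            rw [Fin.val_succ]; omega
          simp only [this, Fin.cons_succ, Fin.cons_zero, Fin.val_zero, h0, if_true]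
          ring
      · rcases le_total (x * f 0 t) y with h | h
        · rw [max_eq_left h]
        -- With the raised floor `z = x * f 0 t` the bound is `log z + 1`, and `log (z / y) ≤ z / y
        -- - 1` turns it into `log y + z / y`.
        · rw [max_eq_right h, div_self hxt.ne']
          have h2 := Real.log_le_sub_one_of_pos (div_pos hxt hy)
          rw [Real.log_div hxt.ne' hy.ne'] at h2
          linarith
    rw [← (Fin.consEquiv (fun _ : Fin (n + 1) => Bool)).sum_comp, Fintype.sum_prod_type]
    simp only [Fin.consEquiv, Equiv.coe_fn_mk, Fintype.sum_bool, Fin.prod_univ_succ (fun i =>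
      w i _), Fin.cons_zero, Fin.cons_succ, mul_assoc, ← Finset.mul_sum]
    have ht := mul_le_mul_of_nonneg_left (step true) (hw 0 true)
    have hf' := mul_le_mul_of_nonneg_left (step false) (hw 0 false)
    refine (add_le_add ht hf').trans ?_
    have e : w 0 true * (Real.log y + x * f 0 true / y) +
        w 0 false * (Real.log y + x * f 0 false / y) =
        (w 0 true + w 0 false) * Real.log y +
          (w 0 true * f 0 true + w 0 false * f 0 false) * (x / y) := by ring
    rw [e, hw1, one_mul]
    have := mul_le_mul_of_nonneg_right (hwf 0) (div_nonneg hx.le hy.le)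
    linarith

/-! ### Selection rules -/

/-- `IsSequential α F`: for some order of the hypotheses and some directions `ψ`, the set selected
from the signs `s` is empty or consists of the hypotheses with sign `ψ` in an initial segment on
which one plus the number of the other hypotheses is at most `α` times the number selected. -/
def IsSequential {d : ℕ} (α : ℝ) (F : (Fin d → Bool) → Finset (Fin d)) : Prop :=
  ∃ (π : Equiv.Perm (Fin d)) (ψ : Fin d → Bool), ∀ s, F s = ∅ ∨ ∃ l : ℕ,
    F s = Finset.univ.filter (fun j => (π.symm j : ℕ) < l ∧ s j = ψ j) ∧
    ((Finset.univ.filter (fun j => (π.symm j : ℕ) < l ∧ s j ≠ ψ j)).card : ℝ) + 1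
      ≤ α * (F s).card

/-- The mean number of selected hypotheses, with respect to independent signs that fall on any
given side with probability at most `1 - q` outside of a set of at most `k` indices. -/
theorem IsSequential.sum_card_le {d : ℕ} {α : ℝ} {F : (Fin d → Bool) → Finset (Fin d)}
    (hF : IsSequential α F) {p lam q c k : ℝ} (hα : 0 < α) (hp : p = α / (1 + α)) (hpl : p < lam)
    (hlq : lam < q) (hq : q < 1)
    (hc : c = lam * Real.log (lam / q) + (1 - lam) * Real.log ((1 - lam) / (1 - q))) (hc0 : 0 < c)
    (w : Fin d → Bool → ℝ) (hw : ∀ i t, 0 ≤ w i t) (hw1 : ∀ i, w i true + w i false = 1)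
    (bad : Finset (Fin d)) (hbad : (bad.card : ℝ) ≤ k) (hgood : ∀ i ∉ bad, ∀ t, w i t ≤ 1 - q) :
    ∑ s : Fin d → Bool, (∏ i, w i (s i)) * ((F s).card : ℝ)
      ≤ (lam / (lam - p) * k + 1 + 1 / c) / (1 + α) := by
  classical
  obtain ⟨π, ψ, hF⟩ := hF
  have hp0 : 0 < p := by rw [hp]; positivity
  have hl0 : 0 < lam := hp0.trans hpl
  have hq0 : 0 < q := hl0.trans hlq
  have hl1 : lam < 1 := hlq.trans hq
  have hk0 : 0 ≤ k := (Nat.cast_nonneg _).trans hbad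
  set a : ℝ := (1 - lam) / (1 - q) with ha
  set b : ℝ := lam / q with hb
  have ha1 : 1 ≤ a := by rw [ha, le_div_iff₀ (by linarith)]; linarith
  have hb0 : 0 < b := div_pos hl0 hq0
  have hb1 : b ≤ 1 := by rw [hb, div_le_one hq0]; exact hlq.le
  have hla : 0 ≤ Real.log a := Real.log_nonneg ha1
  have hlb : Real.log b ≤ 0 := Real.log_nonpos hb0.le hb1
  -- These factors are the likelihood ratio of mismatch probability `lam` against `q`. At a good
  -- index the mean is at most one because `a ≥ b` and a match has probability at most `1 - q`, with
  -- equality `(1 - q) a + q b = 1` in the extreme case.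
  set g : Fin d → Bool → ℝ := fun j t => if j ∈ bad then 1 else if t = ψ j then a else b with hg
  have hg0 : ∀ j t, 0 < g j t := by
    intro j t; simp only [hg]; split_ifs <;> linarith
  have hwg : ∀ j, w j true * g j true + w j false * g j false ≤ 1 := by
    intro j
    by_cases hj : j ∈ bad
    · simp [hg, hj, hw1]
    · have key : ∀ u v : ℝ, u ≤ 1 - q → u + v = 1 → u * a + v * b ≤ 1 := by
        intro u v hu huv
        have hab : u * (a - b) ≤ (1 - q) * (a - b) :=
          mul_le_mul_of_nonneg_right hu (by linarith)
        have e1 : (1 - q) * a = 1 - lam := by rw [ha]; field_simp [show (1 - q) ≠ 0 by linarith]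
        have e2 : q * b = lam := by rw [hb]; field_simp
        have : v = 1 - u := by linarith
        subst this
        nlinarith
      cases hψ : ψ j
      · have := key (w j false) (w j true) (hgood j hj _) (by linarith [hw1 j])
        simp [hg, hj, hψ]; linarith
      · have := key (w j true) (w j false) (hgood j hj _) (by linarith [hw1 j])
        simp [hg, hj, hψ]; linarith
  choose! l hl using fun s (h : F s ≠ ∅) => (hF s).resolve_left h
  set M : (Fin d → Bool) → ℝ := fun s => ∏ j, if (π.symm j : ℕ) < l s then g j (s j) else 1 with hM
  have hM0 : ∀ s, 0 < M s := fun s => Finset.prod_pos fun j _ => by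
    split_ifs; exacts [hg0 _ _, one_pos]
  -- the walk along the order `π`
  have walk : ∑ s : Fin d → Bool, (∏ i, w i (s i)) * Real.log (max 1 (M s)) ≤ 1 := by
    have h := sum_log_max_le (fun i => w (π i)) (fun i => g (π i)) (fun i => hw _) (fun i => hw1 _)
      (fun i => hg0 _) (fun i => hwg _) (fun t => l (t ∘ π.symm)) 1 1 one_pos le_rfl
    rw [Real.log_one, zero_add, div_one] at h
    refine le_trans (le_of_eq ?_) h
    rw [← (Equiv.arrowCongr π (Equiv.refl Bool)).sum_comp]
    refine Finset.sum_congr rfl fun t _ => ?_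
    have hfun : (Equiv.arrowCongr π (Equiv.refl Bool)) t = t ∘ π.symm := by
      ext; simp
    rw [hfun, hM, ← Equiv.prod_comp π (fun i => w i ((t ∘ π.symm) i)), one_mul]
    simp only [Function.comp_apply, Equiv.symm_apply_apply]
    congr 3
    rw [← Equiv.prod_comp π]
    simp only [Equiv.symm_apply_apply]
  have main : ∀ s, ((F s).card : ℝ) * (1 + α) ≤
      lam / (lam - p) * k + 1 + Real.log (max 1 (M s)) / c := by
    intro s
    have hlog : 0 ≤ Real.log (max 1 (M s)) := Real.log_nonneg (le_max_left _ _)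
    have hm0 : 0 ≤ lam / (lam - p) * k := mul_nonneg (div_nonneg hl0.le (by linarith)) hk0
    by_cases hs : F s = ∅
    · have : 0 ≤ Real.log (max 1 (M s)) / c := by positivity
      simp only [hs, Finset.card_empty, Nat.cast_zero, zero_mul]; linarith
    obtain ⟨hFs, hZ⟩ := hl s hs
    set Z := Finset.univ.filter (fun j => (π.symm j : ℕ) < l s ∧ s j ≠ ψ j) with hZdef
    set r : ℝ := ((F s).card : ℝ) with hr
    -- At most `k` of the matches are bad and lose their factor `a`. There are at most `α r - 1`
    -- mismatches, and each costs at most `log b ≤ 0`.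
    have hlogM : (r - k) * Real.log a + (α * r - 1) * Real.log b ≤ Real.log (M s) := by
      have e : Real.log (M s) = ∑ j, Real.log (if (π.symm j : ℕ) < l s then g j (s j) else 1) := by
        rw [hM, Real.log_prod]
        intro j _; split_ifs; exacts [(hg0 _ _).ne', one_ne_zero]
      have e2 : ∑ j, ((if j ∈ F s then Real.log a else 0) - (if j ∈ bad then Real.log a else 0)
          + (if j ∈ Z then Real.log b else 0)) ≤ Real.log (M s) := by
        rw [e]
        refine Finset.sum_le_sum fun j _ => ?_
        rw [hFs, hZdef]
        simp only [Finset.mem_filter, Finset.mem_univ, true_and]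
        by_cases h1 : (π.symm j : ℕ) < l s <;> by_cases h2 : s j = ψ j <;>
          by_cases h3 : j ∈ bad <;> simp [h1, h2, h3, hg, hla, hlb.trans hla]
      rw [Finset.sum_add_distrib, Finset.sum_sub_distrib] at e2
      simp only [Finset.sum_ite_mem, Finset.univ_inter, Finset.sum_const, nsmul_eq_mul] at e2
      have e3 := mul_le_mul_of_nonneg_right hbad hla
      have e4 : (α * r - 1) * Real.log b ≤ (Z.card : ℝ) * Real.log b :=
        mul_le_mul_of_nonpos_right (by linarith) hlb
      have e5 : (r - k) * Real.log a = r * Real.log a - k * Real.log a := by ring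
      linarith
    by_cases hL : r * (1 + α) ≤ lam / (lam - p) * k + 1
    · have : 0 ≤ Real.log (max 1 (M s)) / c := by positivity
      linarith
    · push Not at hL
      -- `L` is the largest segment length compatible with `r` matches. Since `α r - 1 ≤ p L`, once
      -- `L` exceeds `lam / (lam - p) * k` the mismatch bound is at most `lam * (L - k)`, and `log
      -- M` is then at least `L - k` times the divergence `c`.
      set L : ℝ := r * (1 + α) - 1 with hLdef
      have hL1 : lam / (lam - p) * k < L := by linarith
      have hL2 : lam * k < (lam - p) * L := by
        have : lam * k = (lam - p) * (lam / (lam - p) * k) := by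
          field_simp [show lam - p ≠ 0 by linarith]
        rw [this]; exact mul_lt_mul_of_pos_left hL1 (by linarith)
      have hpα : p * (1 + α) = α := by rw [hp]; field_simp
      have hαr : α * r - 1 ≤ lam * (L - k) := by
        have : p * L = α * r - p := by rw [hLdef]; linear_combination r * hpα
        have hp1 : p ≤ 1 := by linarith
        nlinarith
      have hfin : (L - k) * c ≤ Real.log (M s) := by
        have h0 : r - k = L - k - (α * r - 1) := by rw [hLdef]; ring
        rw [h0] at hlogM
        rw [hc]
        nlinarith
      have hkm : k ≤ lam / (lam - p) * k := by
        refine le_mul_of_one_le_left hk0 ?_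
        rw [le_div_iff₀ (by linarith)]; linarith
      have h6 : (L - lam / (lam - p) * k) * c ≤ Real.log (max 1 (M s)) :=
        ((mul_le_mul_of_nonneg_right (by linarith) hc0.le).trans hfin).trans
          (Real.log_le_log (hM0 s) (le_max_right _ _))
      have h7 := (le_div_iff₀ hc0).2 h6
      linarith
  rw [le_div_iff₀ (by linarith), Finset.sum_mul]
  have hsum1 : ∑ s : Fin d → Bool, ∏ i, w i (s i) = 1 := by
    rw [← Fintype.prod_sum]
    exact Finset.prod_eq_one fun i _ => by simp [hw1]
  have hterm : ∀ s : Fin d → Bool, (∏ i, w i (s i)) * ((F s).card : ℝ) * (1 + α) ≤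
      (∏ i, w i (s i)) * (lam / (lam - p) * k + 1) +
        (∏ i, w i (s i)) * Real.log (max 1 (M s)) / c := by
    intro s
    have h := mul_le_mul_of_nonneg_left (main s)
      (Finset.prod_nonneg (s := Finset.univ) fun i _ => hw i (s i))
    rw [mul_assoc]
    exact h.trans (le_of_eq (by ring))
  refine (Finset.sum_le_sum fun s _ => hterm s).trans ?_
  rw [Finset.sum_add_distrib, ← Finset.sum_mul, ← Finset.sum_div, hsum1, one_mul]
  gcongr

/-! ### The explicit constants -/

section Constants

variable {α δ : ℝ}

theorem pOf_pos (hα : 0 < α) : 0 < pOf α := by unfold pOf; positivity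

theorem pOf_lt_qOf (hα : 0 < α) (hδ : 0 < δ) : pOf α < qOf α δ := by
  unfold pOf qOf
  rw [div_lt_div_iff₀ (by linarith) (by linarith)]
  nlinarith

theorem one_sub_qOf (hα : 0 < α) (hδ : 0 < δ) : 1 - qOf α δ = 1 / (1 + (α + δ)) := by
  unfold qOf
  field_simp [show 1 + α + δ ≠ 0 by linarith, show 1 + (α + δ) ≠ 0 by linarith]
  ring

theorem qOf_lt_one (hα : 0 < α) (hδ : 0 < δ) : qOf α δ < 1 := by
  have := one_sub_qOf hα hδ
  have h : 0 < 1 / (1 + (α + δ)) := by positivity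
  linarith

theorem qOf_lt_half (hα : 0 < α) (hδ : 0 < δ) (h : α + δ < 1) : qOf α δ < 1 / 2 := by
  unfold qOf
  rw [div_lt_div_iff₀ (by linarith) (by norm_num)]
  linarith

theorem pOf_lt_lamOf (hα : 0 < α) (hδ : 0 < δ) : pOf α < lamOf α δ := by
  have := pOf_lt_qOf hα hδ
  unfold lamOf; linarith

theorem lamOf_lt_qOf (hα : 0 < α) (hδ : 0 < δ) : lamOf α δ < qOf α δ := by
  have := pOf_lt_qOf hα hδ
  unfold lamOf; linarith

theorem chOf_eq (α δ : ℝ) : chOf α δ = lamOf α δ * Real.log (lamOf α δ / qOf α δ) +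
    (1 - lamOf α δ) * Real.log ((1 - lamOf α δ) / (1 - qOf α δ)) := by
  unfold chOf
  rw [← inv_div (lamOf α δ) (qOf α δ), ← inv_div (1 - lamOf α δ) (1 - qOf α δ), Real.log_inv,
    Real.log_inv]
  ring

/-- Gibbs' inequality from `log x ≤ x - 1`, strict because `λ* ≠ q`. -/
theorem chOf_pos (hα : 0 < α) (hδ : 0 < δ) : 0 < chOf α δ := by
  have h1 := pOf_pos hα
  have h2 := pOf_lt_lamOf hα hδ
  have h3 := lamOf_lt_qOf hα hδ
  have h4 := qOf_lt_one hα hδ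
  unfold chOf
  set l := lamOf α δ
  set q := qOf α δ
  have hl : 0 < l := h1.trans h2
  have hq : 0 < q := hl.trans h3
  have e1 : Real.log (q / l) < q / l - 1 :=
    Real.log_lt_sub_one_of_pos (by positivity) (by rw [Ne, div_eq_one_iff_eq hl.ne']; exact h3.ne')
  have e2 : Real.log ((1 - q) / (1 - l)) ≤ (1 - q) / (1 - l) - 1 :=
    Real.log_le_sub_one_of_pos (div_pos (by linarith) (by linarith))
  have e3 := mul_lt_mul_of_pos_left e1 hl
  have e4 := mul_le_mul_of_nonneg_left e2 (show 0 ≤ 1 - l by linarith)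
  have e5 : l * (q / l - 1) = q - l := by field_simp
  have e6 : (1 - l) * ((1 - q) / (1 - l) - 1) = l - q := by
    field_simp [show 1 - l ≠ 0 by linarith]; ring
  linarith

/-- The Kullback–Leibler divergence is at most the chi-squared divergence. -/
theorem chOf_le (hα : 0 < α) (hδ : 0 < δ) :
    chOf α δ * (16 * (qOf α δ * (1 - qOf α δ))) ≤ 9 * (qOf α δ - pOf α) ^ 2 := by
  have h1 := pOf_pos hα
  have h2 := pOf_lt_lamOf hα hδ
  have h3 := lamOf_lt_qOf hα hδ
  have h4 := qOf_lt_one hα hδ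
  have hlq : qOf α δ - lamOf α δ = 3 / 4 * (qOf α δ - pOf α) := by unfold lamOf; ring
  have h9 : 9 * (qOf α δ - pOf α) ^ 2 = 16 * (qOf α δ - lamOf α δ) ^ 2 := by rw [hlq]; ring
  rw [chOf_eq, h9]
  set l := lamOf α δ
  set q := qOf α δ
  have hl : 0 < l := h1.trans h2
  have hq : 0 < q := hl.trans h3
  have e1 := mul_le_mul_of_nonneg_left (Real.log_le_sub_one_of_pos (div_pos hl hq)) hl.le
  have e2 := mul_le_mul_of_nonneg_left (Real.log_le_sub_one_of_pos
    (div_pos (show 0 < 1 - l by linarith) (show 0 < 1 - q by linarith)))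
    (show 0 ≤ 1 - l by linarith)
  have e3 := mul_le_mul_of_nonneg_right (add_le_add e1 e2)
    (show 0 ≤ 16 * (q * (1 - q)) by nlinarith)
  refine e3.trans (le_of_eq ?_)
  field_simp [show 1 - q ≠ 0 by linarith]
  ring

/-! ### Numerical inequalities for the intercept. -/

theorem three_eighths_le : 3 / 8 ≤ Real.exp 1 / (4 * √Real.pi) := by
  have h1 := Real.exp_one_gt_d9
  have h2 : √Real.pi ≤ 9 / 5 := by
    rw [Real.sqrt_le_left (by norm_num)]
    have := Real.pi_lt_d2
    norm_num; linarith
  rw [le_div_iff₀ (by positivity)]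
  linarith

/-- With `p = u q` the claim becomes `4 u (1 - u)² (1 - u q)² ≤ 1 - q`. The left side is convex in
`q` and the right side is linear, so the endpoints `q = 0` and `q = 1/2` suffice. -/
theorem four_mul_sq_le {p q : ℝ} (hp : 0 < p) (hpq : p < q) (hq : q < 1 / 2) :
    4 * (q - p) ^ 2 * p * (1 - p) ^ 2 ≤ q ^ 3 * (1 - q) := by
  obtain ⟨u, rfl⟩ : ∃ u, p = u * q := ⟨p / q, by field_simp [show q ≠ 0 by linarith]⟩
  have hq0 : 0 < q := hp.trans hpq
  have hu0 : 0 < u := by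
    by_contra hu
    push Not at hu
    nlinarith
  have hu1 : u < 1 := by nlinarith
  have h0 : 4 * u * (1 - u) ^ 2 ≤ 1 := by nlinarith [sq_nonneg (u - 1 / 3), mul_pos hu0 hu0]
  have h1 : 4 * u * (1 - u) ^ 2 * (1 - u / 2) ^ 2 ≤ 1 / 2 := by
    have hcub : 27 * (u * (1 - u) ^ 2) ≤ 4 := by
      have : 0 ≤ (3 * u - 1) ^ 2 * (4 - 3 * u) := mul_nonneg (sq_nonneg _) (by linarith)
      nlinarith
    have hcub0 : 0 ≤ u * (1 - u) ^ 2 := by positivity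
    -- The split is needed because `u (1 - u)² ≤ 4/27` alone is too weak. Below `1/6` this factor is
    -- at most its value `25/216` there; above `1/6` the other factor is at most `(11/12)²`, which
    -- just suffices.
    rcases le_total u (1 / 6) with h6 | h6
    · have a1 : u * (1 - u) ^ 2 ≤ 25 / 216 := by
        have : 0 ≤ (1 / 6 - u) * (25 / 36 - 11 / 6 * u + u ^ 2) :=
          mul_nonneg (by linarith) (by nlinarith)
        nlinarith
      have a2 : (1 - u / 2) ^ 2 ≤ 1 := pow_le_one₀ (by linarith) (by linarith)
      nlinarith [mul_le_mul a1 a2 (sq_nonneg _) (by norm_num)]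
    · have a2 : (1 - u / 2) ^ 2 ≤ (11 / 12) ^ 2 := pow_le_pow_left₀ (by linarith) (by linarith) 2
      nlinarith [mul_le_mul hcub a2 (sq_nonneg _) (by norm_num)]
  have hconv : (1 - u * q) ^ 2 ≤ (1 - 2 * q) + 2 * q * (1 - u / 2) ^ 2 := by
    nlinarith [mul_nonneg (mul_nonneg hq0.le (show 0 ≤ 1 - 2 * q by linarith)) (sq_nonneg u)]
  have h2 : 4 * u * (1 - u) ^ 2 * (1 - u * q) ^ 2 ≤ 1 - q := by
    have h3 := mul_le_mul_of_nonneg_left hconv (show 0 ≤ 4 * u * (1 - u) ^ 2 by positivity)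
    have h4 := mul_le_mul_of_nonneg_left h0 (show 0 ≤ 1 - 2 * q by linarith)
    have h5 := mul_le_mul_of_nonneg_left h1 (show 0 ≤ 2 * q by linarith)
    nlinarith
  have h6 := mul_le_mul_of_nonneg_left h2 (show 0 ≤ q ^ 3 by positivity)
  refine le_trans (le_of_eq ?_) h6
  ring

/-- After division by `c_h ^ (-3/2)` this is an upper bound for `√c_h`. The chi-squared bound
`chOf_le` makes it an inequality between rational functions of `p` and `q`, one for each value of
the minimum. The constant `e / (4 √π)` enters only through being at least `3/8`. -/
theorem inv_chOf_le (hα : 0 < α) (hδ : 0 < δ) (h : α + δ < 1) :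
    1 / chOf α δ ≤ Real.exp 1 / (4 * √Real.pi) *
      (√(1 + α) * qOf α δ / √(pOf α * (1 - pOf α))) * chOf α δ ^ (-(3 / 2) : ℝ) *
      min (2 * (qOf α δ - pOf α) / (pOf α * (1 - qOf α δ))) 1 := by
  have hc := chOf_pos hα hδ
  have hcle := chOf_le hα hδ
  have hp := pOf_pos hα
  have hpq := pOf_lt_qOf hα hδ
  have hq := qOf_lt_half hα hδ h
  have h1α : 1 + α = 1 / (1 - pOf α) := by unfold pOf; field_simp; ring
  rw [h1α]
  generalize chOf α δ = c at *
  generalize qOf α δ = q at *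
  generalize pOf α = p at *
  clear h1α
  have hq0 : 0 < q := hp.trans hpq
  have hp1 : 0 < 1 - p := by linarith
  have hq1 : 0 < 1 - q := by linarith
  set m := min (2 * (q - p) / (p * (1 - q))) 1 with hm
  have hm0 : 0 ≤ m := le_min (div_nonneg (by linarith) (by positivity)) zero_le_one
  have e1 : √(1 / (1 - p)) * q / √(p * (1 - p)) = q / (√p * (1 - p)) := by
    rw [Real.sqrt_div zero_le_one, Real.sqrt_one, Real.sqrt_mul hp.le]
    have := Real.mul_self_sqrt hp1.le
    have : 0 < √(1 - p) := Real.sqrt_pos.2 hp1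
    have : 0 < √p := Real.sqrt_pos.2 hp
    rw [div_mul_eq_mul_div, div_div, one_mul]
    congr 1
    linear_combination √p * Real.mul_self_sqrt hp1.le
  have hcq : c * (p * (1 - p) ^ 2) ≤ (3 / 8 * q * m) ^ 2 := by
    have hX : c * (16 * (q * (1 - q))) * (p * (1 - p) ^ 2) ≤
        (3 / 8 * q * m) ^ 2 * (16 * (q * (1 - q))) := by
      refine (mul_le_mul_of_nonneg_right hcle (by positivity)).trans ?_
      rcases min_choice (2 * (q - p) / (p * (1 - q))) 1 with h' | h'
      · rw [hm, h']
        have : (3 / 8 * q * (2 * (q - p) / (p * (1 - q)))) ^ 2 * (16 * (q * (1 - q))) =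
          9 * (q - p) ^ 2 * (q ^ 3 / (p ^ 2 * (1 - q))) := by field_simp; ring
        rw [this]
        refine mul_le_mul_of_nonneg_left ?_ (by positivity)
        rw [le_div_iff₀ (by positivity)]
        have a1 : p ^ 3 ≤ q ^ 3 := pow_le_pow_left₀ hp.le hpq.le 3
        have a2 : (1 - p) ^ 2 * (1 - q) ≤ 1 :=
          mul_le_one₀ (pow_le_one₀ hp1.le (by linarith)) hq1.le (by linarith)
        calc p * (1 - p) ^ 2 * (p ^ 2 * (1 - q)) = p ^ 3 * ((1 - p) ^ 2 * (1 - q)) := by ring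
          _ ≤ q ^ 3 * 1 := mul_le_mul a1 a2 (by positivity) (by positivity)
          _ = q ^ 3 := mul_one _
      · rw [hm, h']
        have := four_mul_sq_le hp hpq hq
        nlinarith
    have h16 : 0 < 16 * (q * (1 - q)) := by positivity
    refine le_of_mul_le_mul_right ?_ h16
    linarith [hX]
  have hs : √c ≤ 3 / 8 * (q / (√p * (1 - p))) * m := by
    have hsp : 0 < √p := Real.sqrt_pos.2 hp
    have h1 : √c * (√p * (1 - p)) ≤ 3 / 8 * q * m := by
      have : √c * (√p * (1 - p)) = √(c * (p * (1 - p) ^ 2)) := by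
        rw [Real.sqrt_mul hc.le, Real.sqrt_mul hp.le, Real.sqrt_sq hp1.le]
      rw [this]
      exact Real.sqrt_le_iff.2 ⟨by positivity, hcq⟩
    have h2 := (le_div_iff₀ (by positivity)).2 h1
    refine h2.trans (le_of_eq ?_)
    ring
  have hcr : 1 / c = √c * c ^ (-(3 / 2) : ℝ) := by
    rw [Real.sqrt_eq_rpow, ← Real.rpow_add hc, one_div, ← Real.rpow_neg_one]
    norm_num
  have hr : 0 ≤ c ^ (-(3 / 2) : ℝ) := Real.rpow_nonneg hc.le _
  rw [e1, hcr]
  calc √c * c ^ (-(3 / 2) : ℝ) ≤ (3 / 8 * (q / (√p * (1 - p))) * m) * c ^ (-(3 / 2) : ℝ) :=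
        mul_le_mul_of_nonneg_right hs hr
    _ ≤ (Real.exp 1 / (4 * √Real.pi) * (q / (√p * (1 - p))) * m) * c ^ (-(3 / 2) : ℝ) := by
        have h38 := three_eighths_le
        gcongr ?_ * _ * _ * _
    _ = _ := by ring

/-- The bound for sequential selection rules is at most the linear bound with the explicit
constants. -/
theorem bound_le_explicit (hα : 0 < α) (hδ : 0 < δ) (h : α + δ < 1) {k : ℝ} (hk : 0 ≤ k) :
    (lamOf α δ / (lamOf α δ - pOf α) * k + 1 + 1 / chOf α δ) / (1 + α)
      ≤ C₁ α δ * k + C₂ α δ := by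
  have h1 := inv_chOf_le hα hδ h
  have h2 : lamOf α δ / (lamOf α δ - pOf α) ≤ max 1 (4 * α * (1 + α + δ) / δ) + 1 := by
    -- The factor `4` is the quarter in the definition of `λ*`, through `λ* - p = (q - p) / 4`.
    have : lamOf α δ / (lamOf α δ - pOf α) = 4 * α * (1 + α + δ) / δ + 1 := by
      have e : qOf α δ - pOf α = δ / ((1 + α) * (1 + α + δ)) := by
        unfold qOf pOf; field_simp; ring
      have e2 : lamOf α δ - pOf α = (qOf α δ - pOf α) / 4 := by unfold lamOf; ring
      have e3 : lamOf α δ = pOf α + (qOf α δ - pOf α) / 4 := rfl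
      rw [e2, e3, e]
      unfold pOf
      field_simp
    rw [this]
    linarith [le_max_right 1 (4 * α * (1 + α + δ) / δ)]
  have h3 := mul_le_mul_of_nonneg_right h2 hk
  unfold C₁ C₂
  rw [div_le_iff₀ (by linarith)]
  have h4 : 1 / (1 + α) * (1 + α) = 1 := by field_simp
  generalize Real.exp 1 / (4 * √Real.pi) *
      (√(1 + α) * qOf α δ / √(pOf α * (1 - pOf α))) * chOf α δ ^ (-(3 / 2) : ℝ) *
      min (2 * (qOf α δ - pOf α) / (pOf α * (1 - qOf α δ))) 1 = K at *
  generalize max 1 (4 * α * (1 + α + δ) / δ) = N at *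
  have h5 : (1 / (1 + α) * (N + 1) * k + 1 / (1 + α) * (K + 2)) * (1 + α) =
      (N + 1) * k + (K + 2) := by linear_combination ((N + 1) * k + (K + 2)) * h4
  rw [h5]
  linarith

end Constants

/-! ### The conditional law of the signs of Gaussian variables given their absolute values -/

/-- The conditional probability that a `N(m, v)` variable with absolute value `x` is positive
(for `t = true`) or not (for `t = false`). -/
def signProb (m : ℝ) (v : ℝ≥0) (t : Bool) (x : ℝ) : ℝ :=
  1 / (1 + Real.exp (-((if t then 1 else -1) * (2 * m * x / v))))

theorem signProb_pos (m : ℝ) (v : ℝ≥0) (t : Bool) (x : ℝ) : 0 < signProb m v t x := by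
  unfold signProb; positivity

theorem signProb_add (m : ℝ) (v : ℝ≥0) (x : ℝ) :
    signProb m v true x + signProb m v false x = 1 := by
  unfold signProb
  simp only [if_true, Bool.false_eq_true, if_false, one_mul, neg_mul, neg_neg, Real.exp_neg]
  have := Real.exp_pos (2 * m * x / v)
  field_simp
  ring

@[fun_prop]
theorem measurable_signProb (m : ℝ) (v : ℝ≥0) (t : Bool) : Measurable (signProb m v t) := by
  unfold signProb; fun_prop

theorem measurableSet_decide_pos (t : Bool) : MeasurableSet {b : ℝ | decide (0 < b) = t} := by
  cases t
  · have : {b : ℝ | decide (0 < b) = false} = Set.Iic 0 := by ext; simp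
    rw [this]; exact measurableSet_Iic
  · have : {b : ℝ | decide (0 < b) = true} = Set.Ioi 0 := by ext; simp
    rw [this]; exact measurableSet_Ioi

theorem gaussianPDFReal_eq_signProb_mul (m : ℝ) {v : ℝ≥0} (hv : v ≠ 0) (x : ℝ) :
    gaussianPDFReal m v x =
      signProb m v true x * (gaussianPDFReal m v x + gaussianPDFReal m v (-x)) := by
  have hv' : (v : ℝ) ≠ 0 := by exact_mod_cast hv
  -- The density ratio at `-x` and `x` gives the log-odds `2 m x / v`, hence the logistic form of
  -- `signProb`.
  have h : gaussianPDFReal m v (-x) = Real.exp (-(2 * m * x / v)) * gaussianPDFReal m v x := by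
    simp only [gaussianPDFReal]
    rw [mul_left_comm, ← Real.exp_add]
    congr 2
    field_simp
    ring
  rw [h]
  unfold signProb
  simp only [if_true, one_mul]
  have := Real.exp_pos (-(2 * m * x / v))
  field_simp

theorem gaussianPDFReal_neg_eq_signProb_mul (m : ℝ) {v : ℝ≥0} (hv : v ≠ 0) (x : ℝ) :
    gaussianPDFReal m v (-x) =
      signProb m v false x * (gaussianPDFReal m v x + gaussianPDFReal m v (-x)) := by
  have h1 := gaussianPDFReal_eq_signProb_mul m hv x
  have h2 := signProb_add m v x
  linear_combination (-1 : ℝ) * h1 - (gaussianPDFReal m v x + gaussianPDFReal m v (-x)) * h2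

theorem lintegral_eq_lintegral_Ioi_add (g : ℝ → ℝ≥0∞) (hg : Measurable g) :
    ∫⁻ b, g b = ∫⁻ b in Set.Ioi 0, g b + g (-b) := by
  have h1 : ∫⁻ b in Set.Iic 0, g b = ∫⁻ b in Set.Ioi 0, g (-b) := by
    have h := (Measure.measurePreserving_neg (volume : Measure ℝ)).setLIntegral_comp_preimage
      (measurableSet_Iio (a := (0 : ℝ))) hg
    rw [setLIntegral_congr Iio_ae_eq_Iic.symm, ← h]
    congr 2
    ext; simp
  rw [← lintegral_add_compl g (measurableSet_Ioi (a := (0 : ℝ))), Set.compl_Ioi, h1,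
    lintegral_add_left hg]

/-- Conditioning on `|b|` in integrated form: folding the line onto `(0, ∞)` pairs the densities at
`x` and `-x`, and each one is its share `signProb` of their sum. -/
theorem setLIntegral_abs_gaussianReal (m : ℝ) {v : ℝ≥0} (hv : v ≠ 0) (t : Bool)
    (f : ℝ → ℝ≥0∞) (hf : Measurable f) :
    ∫⁻ b in {b | decide (0 < b) = t}, f |b| ∂(gaussianReal m v) =
      ∫⁻ b, ENNReal.ofReal (signProb m v t |b|) * f |b| ∂(gaussianReal m v) := by
  have hS := measurableSet_decide_pos t
  have hm : Measurable (gaussianPDF m v) := measurable_gaussianPDF m v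
  have hfa : Measurable fun b : ℝ => f |b| := hf.comp measurable_norm
  have hpa : Measurable fun b : ℝ => ENNReal.ofReal (signProb m v t |b|) :=
    ((measurable_signProb m v t).comp measurable_norm).ennreal_ofReal
  have hi : Measurable (fun b : ℝ => Set.indicator {b | decide (0 < b) = t} (fun b => f |b|) b) :=
    hfa.indicator hS
  change _ = ∫⁻ b, ((fun b : ℝ => ENNReal.ofReal (signProb m v t |b|)) * fun b => f |b|) b ∂_
  rw [← lintegral_indicator hS, gaussianReal_of_var_ne_zero m hv,
    lintegral_withDensity_eq_lintegral_mul _ hm hi,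
    lintegral_withDensity_eq_lintegral_mul _ hm (hpa.mul hfa),
    lintegral_eq_lintegral_Ioi_add _ (hm.mul hi),
    lintegral_eq_lintegral_Ioi_add _ (hm.mul (hpa.mul hfa))]
  refine setLIntegral_congr_fun measurableSet_Ioi fun x hx => ?_
  have hx : 0 < x := hx
  simp only [Pi.mul_apply, abs_neg, abs_of_pos hx, gaussianPDF_def]
  have h1 := signProb_pos m v t x
  have h2 := gaussianPDFReal_nonneg m v x
  have h3 := gaussianPDFReal_nonneg m v (-x)
  rw [← mul_assoc, ← mul_assoc, ← add_mul, ← add_mul, ← ENNReal.ofReal_add h2 h3,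
    mul_comm (ENNReal.ofReal (_ + _)), ← ENNReal.ofReal_mul h1.le]
  cases t
  · rw [← gaussianPDFReal_neg_eq_signProb_mul m hv x]
    simp [Set.indicator, hx.not_ge, hx.not_gt, abs_of_pos hx]
  · rw [← gaussianPDFReal_eq_signProb_mul m hv x]
    simp [Set.indicator, hx, hx.not_gt, abs_of_pos hx]

variable {d : ℕ}

/-- The signs of a vector. -/
def signs (b : Fin d → ℝ) (j : Fin d) : Bool := decide (0 < b j)

/-- The product measure version of `setLIntegral_abs_gaussianReal`, as an identity of measures. -/
theorem map_abs_restrict_pi_gaussianReal (m : Fin d → ℝ) (v : Fin d → ℝ≥0) (hv : ∀ j, v j ≠ 0)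
    (s : Fin d → Bool) :
    ((Measure.pi fun j => gaussianReal (m j) (v j)).restrict {b | signs b = s}).map
        (fun b j => |b j|) =
      ((Measure.pi fun j => gaussianReal (m j) (v j)).withDensity
        (fun b => ENNReal.ofReal (∏ j, signProb (m j) (v j) (s j) |b j|))).map
        (fun b j => |b j|) := by
  have habs : Measurable fun (b : Fin d → ℝ) j => |b j| :=
    measurable_pi_lambda _ fun j => measurable_norm.comp (measurable_pi_apply j)
  have hpi : {b : Fin d → ℝ | signs b = s} = Set.pi Set.univ
      fun j => {x : ℝ | decide (0 < x) = s j} := by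
    ext b; simp [signs, funext_iff]
  set ρ : Fin d → Measure ℝ := fun j =>
    ((gaussianReal (m j) (v j)).restrict {x : ℝ | decide (0 < x) = s j}).map (fun x => |x|) with hρ
  have hfin : ∀ j, IsFiniteMeasure (ρ j) := fun j => by rw [hρ]; infer_instance
  have hpre : ∀ S : Fin d → Set ℝ, (fun (b : Fin d → ℝ) j => |b j|) ⁻¹' (Set.pi Set.univ S) =
      Set.pi Set.univ fun j => (fun x : ℝ => |x|) ⁻¹' S j := fun S => by ext; simp
  have habs1 : Measurable fun x : ℝ => |x| := measurable_norm
  -- Both sides are the product of the one-dimensional laws `ρ j`, which can be checked on boxes. On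
  -- the weighted side, independence of the coordinates factors the integral.
  trans Measure.pi ρ
  · symm
    refine Measure.pi_eq fun S hS => ?_
    rw [Measure.map_apply habs (MeasurableSet.univ_pi hS), hpi, Measure.restrict_pi_pi, hpre,
      Measure.pi_pi]
    exact Finset.prod_congr rfl fun j _ => by rw [hρ, Measure.map_apply habs1 (hS j)]
  · refine Measure.pi_eq fun S hS => ?_
    have hmS : MeasurableSet ((fun (b : Fin d → ℝ) j => |b j|) ⁻¹' (Set.pi Set.univ S)) :=
      habs (MeasurableSet.univ_pi hS)
    rw [Measure.map_apply habs (MeasurableSet.univ_pi hS), withDensity_apply _ hmS,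
      ← lintegral_indicator hmS]
    set g : Fin d → ℝ → ℝ≥0∞ := fun j x =>
      ENNReal.ofReal (signProb (m j) (v j) (s j) |x|) * (S j).indicator 1 |x| with hg
    have hgm : ∀ j, Measurable (g j) := fun j => by
      refine Measurable.mul ?_ ?_
      · exact ((measurable_signProb _ _ _).comp habs1).ennreal_ofReal
      · exact (measurable_one.indicator (hS j)).comp habs1
    have hind : iIndepFun (fun j (b : Fin d → ℝ) => g j (b j))
        (Measure.pi fun j => gaussianReal (m j) (v j)) :=
      iIndepFun_pi (X := g) fun j => (hgm j).aemeasurable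
    have hprod := lintegral_prod_eq_prod_lintegral_of_indepFun Finset.univ _ hind
      (fun j => (hgm j).comp (measurable_pi_apply j))
    trans ∫⁻ b, ∏ j, g j (b j) ∂(Measure.pi fun j => gaussianReal (m j) (v j))
    · refine lintegral_congr fun b => ?_
      rw [hg, Finset.prod_mul_distrib,
        ← ENNReal.ofReal_prod_of_nonneg fun j _ => (signProb_pos _ _ _ _).le]
      by_cases hb : b ∈ (fun (b : Fin d → ℝ) j => |b j|) ⁻¹' (Set.pi Set.univ S)
      · rw [Set.indicator_of_mem hb, Finset.prod_eq_one (s := Finset.univ)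
          (f := fun j => (S j).indicator (1 : ℝ → ℝ≥0∞) |b j|), mul_one]
        intro j _
        have : |b j| ∈ S j := hb j (Set.mem_univ j)
        simp [this]
      · rw [Set.indicator_of_notMem hb]
        simp only [Set.mem_preimage, Set.mem_univ_pi, not_forall] at hb
        obtain ⟨j, hj⟩ := hb
        rw [Finset.prod_eq_zero (f := fun j => (S j).indicator (1 : ℝ → ℝ≥0∞) |b j|)
          (Finset.mem_univ j) (by simp [hj]), mul_zero]
    · rw [hprod]
      refine Finset.prod_congr rfl fun j _ => ?_
      have h1 : ∫⁻ b, g j (b j) ∂(Measure.pi fun j => gaussianReal (m j) (v j)) =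
          ∫⁻ x, g j x ∂(gaussianReal (m j) (v j)) :=
        (measurePreserving_eval (fun j => gaussianReal (m j) (v j)) j).lintegral_comp (hgm j)
      rw [h1, hg, ← setLIntegral_abs_gaussianReal (m j) (hv j) (s j) _
        (measurable_one.indicator (hS j)), hρ, Measure.map_apply habs1 (hS j)]
      have : (fun b : ℝ => (S j).indicator (1 : ℝ → ℝ≥0∞) |b|) =
          ((fun x : ℝ => |x|) ⁻¹' S j).indicator 1 := by
        rfl
      rw [this, lintegral_indicator_one (habs1 (hS j))]

/-! ### Conditional expectations of functions of the signs. -/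

theorem measurableSet_signs_eq {d : ℕ} (s : Fin d → Bool) :
    MeasurableSet {b : Fin d → ℝ | signs b = s} := by
  have : {b : Fin d → ℝ | signs b = s} = Set.pi Set.univ
      fun j => {x : ℝ | decide (0 < x) = s j} := by
    ext b; simp [signs, funext_iff]
  rw [this]
  exact MeasurableSet.univ_pi fun j => measurableSet_decide_pos _

theorem measurable_apply_signs {Ω E' : Type*} [MeasurableSpace Ω] [MeasurableSpace E'] {d : ℕ}
    {b : Ω → Fin d → ℝ} {e : Ω → E'} (hb : Measurable b) (he : Measurable e)
    {G : E' → (Fin d → Bool) → ℝ} (hG : ∀ s, Measurable fun x => G x s) :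
    Measurable fun ω => G (e ω) (signs (b ω)) := by
  have : (fun ω => G (e ω) (signs (b ω))) = fun ω =>
      ∑ s, {b : Fin d → ℝ | signs b = s}.indicator (fun _ => (1 : ℝ)) (b ω) * G (e ω) s := by
    ext ω
    simp [Set.indicator]
  rw [this]
  exact Finset.measurable_sum _ fun s _ =>
    ((measurable_const.indicator (measurableSet_signs_eq s)).comp hb).mul ((hG s).comp he)

/-- Conditionally on the absolute values `|b|` of independent Gaussian variables, and on an
independent variable `ξ`, the signs are independent with probabilities `signProb`. -/
theorem condExp_signs {Ω E : Type*} [mΩ : MeasurableSpace Ω] [mE : MeasurableSpace E] {d : ℕ}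
    (μ : Measure Ω) [IsProbabilityMeasure μ] (ξ : Ω → E) (b : Ω → Fin d → ℝ)
    (hξ : Measurable ξ) (hb : Measurable b) (m : Fin d → ℝ) (v : Fin d → ℝ≥0) (hv : ∀ j, v j ≠ 0)
    (hlaw : ∀ j, HasLaw (fun ω => b ω j) (gaussianReal (m j) (v j)) μ)
    (hind : iIndepFun (fun j ω => b ω j) μ) (hξb : IndepFun ξ b μ)
    (G : E × (Fin d → ℝ) → (Fin d → Bool) → ℝ) (hG : ∀ s, Measurable fun e => G e s)
    (hG0 : ∀ e s, 0 ≤ G e s) (C : ℝ) (hGC : ∀ e s, G e s ≤ C) :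
    μ[fun ω => G (ξ ω, fun j => |b ω j|) (signs (b ω)) |
        MeasurableSpace.comap (fun ω => (ξ ω, fun j => |b ω j|)) inferInstance] =ᵐ[μ]
      fun ω => ∑ s, (∏ j, signProb (m j) (v j) (s j) |b ω j|) * G (ξ ω, fun j => |b ω j|) s := by
  have habs : Measurable fun (b : Fin d → ℝ) j => |b j| :=
    measurable_pi_lambda _ fun j => measurable_norm.comp (measurable_pi_apply j)
  set e : Ω → E × (Fin d → ℝ) := fun ω => (ξ ω, fun j => |b ω j|) with he
  have hem : Measurable e := hξ.prodMk (habs.comp hb)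
  have hpi : μ.map b = Measure.pi fun j => gaussianReal (m j) (v j) := by
    have := (iIndepFun_iff_map_fun_eq_pi_map fun j => (hlaw j).aemeasurable).1 hind
    rw [this]
    congr 1
    exact funext fun j => (hlaw j).map_eq
  have hjoint : μ.map (fun ω => (ξ ω, b ω)) =
      (μ.map ξ).prod (Measure.pi fun j => gaussianReal (m j) (v j)) := by
    rw [← hpi]
    exact (indepFun_iff_map_prod_eq_prod_map_map hξ.aemeasurable hb.aemeasurable).1 hξb
  set W : (Fin d → Bool) → (Fin d → ℝ) → ℝ := fun s x => ∏ j, signProb (m j) (v j) (s j) (x j)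
    with hW
  have hWm : ∀ s, Measurable (W s) := fun s => by
    refine Finset.measurable_prod _ fun j _ => ?_
    exact (measurable_signProb _ _ _).comp (measurable_pi_apply j)
  have hW0 : ∀ s x, 0 ≤ W s x := fun s x => Finset.prod_nonneg fun j _ => (signProb_pos _ _ _ _).le
  have hW1 : ∀ x, ∑ s, W s x = 1 := fun x => by
    refine (Fintype.prod_sum fun j t => signProb (m j) (v j) t (x j)).symm.trans ?_
    exact Finset.prod_eq_one fun i _ => by simp [signProb_add]
  have hbS : ∀ s, MeasurableSet {ω | signs (b ω) = s} := fun s => hb (measurableSet_signs_eq s)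
  -- the identity for nonnegative functions
  have key : ∀ (s : Fin d → Bool) (H : E × (Fin d → ℝ) → ℝ≥0∞), Measurable H →
      ∫⁻ ω in {ω | signs (b ω) = s}, H (e ω) ∂μ =
        ∫⁻ ω, ENNReal.ofReal (W s (e ω).2) * H (e ω) ∂μ := by
    intro s H hH
    have hSm := measurableSet_signs_eq s
    have hm1 : Measurable fun p : E × (Fin d → ℝ) =>
        {b : Fin d → ℝ | signs b = s}.indicator (fun _ => (1 : ℝ≥0∞)) p.2 *
          H (p.1, fun j => |p.2 j|) :=
      ((measurable_const.indicator hSm).comp measurable_snd).mul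
        (hH.comp (measurable_fst.prodMk (habs.comp measurable_snd)))
    have hm2 : Measurable fun p : E × (Fin d → ℝ) =>
        ENNReal.ofReal (W s fun j => |p.2 j|) * H (p.1, fun j => |p.2 j|) :=
      (((hWm s).comp (habs.comp measurable_snd)).ennreal_ofReal).mul
        (hH.comp (measurable_fst.prodMk (habs.comp measurable_snd)))
    have hpair : Measurable fun ω => (ξ ω, b ω) := hξ.prodMk hb
    trans ∫⁻ p, {b : Fin d → ℝ | signs b = s}.indicator (fun _ => (1 : ℝ≥0∞)) p.2 *
          H (p.1, fun j => |p.2 j|) ∂(μ.map (fun ω => (ξ ω, b ω)))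
    · rw [lintegral_map hm1 hpair, ← lintegral_indicator (hbS s)]
      refine lintegral_congr fun ω => ?_
      by_cases h : signs (b ω) = s <;> simp [Set.indicator, h, he]
    trans ∫⁻ p, ENNReal.ofReal (W s fun j => |p.2 j|) * H (p.1, fun j => |p.2 j|)
        ∂(μ.map (fun ω => (ξ ω, b ω)))
    swap
    · rw [lintegral_map hm2 hpair]
    -- By independence `ξ` can be frozen at `x`, and what remains is the identity of measures for
    -- the Gaussian vector alone.
    rw [hjoint, lintegral_prod _ hm1.aemeasurable, lintegral_prod _ hm2.aemeasurable]
    refine lintegral_congr fun x => ?_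
    have hHx : Measurable fun z => H (x, z) := hH.comp measurable_prodMk_left
    have h : ∫⁻ z, H (x, z) ∂_ = ∫⁻ z, H (x, z) ∂_ :=
      congrArg (fun ν => ∫⁻ z, H (x, z) ∂ν) (map_abs_restrict_pi_gaussianReal m v hv s)
    rw [lintegral_map hHx habs, lintegral_map hHx habs, ← lintegral_indicator hSm] at h
    refine Eq.trans (lintegral_congr fun z => ?_) (h.trans
      (lintegral_withDensity_eq_lintegral_mul _ ((hWm s).comp habs).ennreal_ofReal
        (hHx.comp habs)))
    by_cases hz : signs z = s <;> simp [Set.indicator, hz]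
  set f : Ω → ℝ := fun ω => G (e ω) (signs (b ω)) with hf
  set g : E × (Fin d → ℝ) → ℝ := fun x => ∑ s, W s x.2 * G x s with hg
  have hgm : Measurable g :=
    Finset.measurable_sum _ fun s _ => ((hWm s).comp measurable_snd).mul (hG s)
  have hg0 : ∀ x, 0 ≤ g x := fun x => Finset.sum_nonneg fun s _ => mul_nonneg (hW0 _ _) (hG0 _ _)
  have hgC : ∀ x, g x ≤ C := fun x => by
    calc g x ≤ ∑ s, W s x.2 * C :=
          Finset.sum_le_sum fun s _ => mul_le_mul_of_nonneg_left (hGC _ _) (hW0 _ _)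
      _ = C := by rw [← Finset.sum_mul, hW1, one_mul]
  have hfm : Measurable f := measurable_apply_signs hb hem hG
  have hfi : Integrable f μ := by
    refine Integrable.of_bound hfm.aestronglyMeasurable C (ae_of_all _ fun ω => ?_)
    rw [Real.norm_of_nonneg (hG0 _ _)]; exact hGC _ _
  have hgi : Integrable (fun ω => g (e ω)) μ := by
    refine Integrable.of_bound (hgm.comp hem).aestronglyMeasurable C (ae_of_all _ fun ω => ?_)
    rw [Real.norm_of_nonneg (hg0 _)]; exact hgC _
  have hle : MeasurableSpace.comap e inferInstance ≤ mΩ := hem.comap_le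
  refine (ae_eq_condExp_of_forall_setIntegral_eq hle hfi (fun s _ _ => hgi.integrableOn) ?_
    ?_).symm
  -- Events of the conditioning σ-algebra are preimages of sets `A`. Splitting by sign pattern
  -- reduces each to `key`, with `H` the statistic cut off to `A`.
  · rintro _ ⟨A, hA, rfl⟩ -
    rw [integral_eq_lintegral_of_nonneg_ae (ae_of_all _ fun ω => hg0 _)
        (hgm.comp hem).aestronglyMeasurable.restrict,
      integral_eq_lintegral_of_nonneg_ae (ae_of_all _ fun ω => hG0 _ _)
        hfm.aestronglyMeasurable.restrict]
    congr 1
    have hAm : MeasurableSet (e ⁻¹' A) := hem hA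
    have hHm : ∀ s, Measurable (A.indicator fun x => ENNReal.ofReal (G x s)) := fun s =>
      ((hG s).ennreal_ofReal).indicator hA
    have h1 : ∫⁻ ω in e ⁻¹' A, ENNReal.ofReal (g (e ω)) ∂μ =
        ∑ s, ∫⁻ ω, ENNReal.ofReal (W s (e ω).2) *
          A.indicator (fun x => ENNReal.ofReal (G x s)) (e ω) ∂μ := by
      rw [← lintegral_indicator hAm, ← lintegral_finsetSum]
      · refine lintegral_congr fun ω => ?_
        by_cases h : e ω ∈ A
        · have h' : ω ∈ e ⁻¹' A := h
          simp only [Set.indicator_of_mem h, Set.indicator_of_mem h', hg]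
          rw [ENNReal.ofReal_sum_of_nonneg fun s _ => mul_nonneg (hW0 _ _) (hG0 _ _)]
          exact Finset.sum_congr rfl fun s _ => ENNReal.ofReal_mul (hW0 _ _)
        · have h' : ω ∉ e ⁻¹' A := h
          simp [Set.indicator_of_notMem h, Set.indicator_of_notMem h']
      · intro s _
        exact (((hWm s).comp (measurable_snd.comp hem)).ennreal_ofReal).mul ((hHm s).comp hem)
    have h2 : ∫⁻ ω in e ⁻¹' A, ENNReal.ofReal (f ω) ∂μ =
        ∑ s, ∫⁻ ω in {ω | signs (b ω) = s},
          A.indicator (fun x => ENNReal.ofReal (G x s)) (e ω) ∂μ := by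
      have : ∀ s, ∫⁻ ω in {ω | signs (b ω) = s},
          A.indicator (fun x => ENNReal.ofReal (G x s)) (e ω) ∂μ =
          ∫⁻ ω, {ω | signs (b ω) = s}.indicator (fun ω =>
            A.indicator (fun x => ENNReal.ofReal (G x s)) (e ω)) ω ∂μ := fun s => by
        rw [lintegral_indicator (hbS s)]
      simp only [this]
      rw [← lintegral_indicator hAm, ← lintegral_finsetSum]
      · refine lintegral_congr fun ω => ?_
        have : ∀ s, {ω | signs (b ω) = s}.indicator (fun ω =>
            A.indicator (fun x => ENNReal.ofReal (G x s)) (e ω)) ω =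
            if signs (b ω) = s then A.indicator (fun x => ENNReal.ofReal (G x s)) (e ω) else 0 :=
          fun s => by by_cases h : signs (b ω) = s <;> simp [Set.indicator, h]
        simp only [this, Finset.sum_ite_eq, Finset.mem_univ, if_true]
        rfl
      · exact fun s _ => ((hHm s).comp hem).indicator (hbS s)
    rw [h1, h2]
    exact Finset.sum_congr rfl fun s _ => (key s _ (hHm s)).symm
  · refine StronglyMeasurable.aestronglyMeasurable ?_
    exact (hgm.comp (comap_measurable e)).stronglyMeasurable

section

/-! ### Gaussian vectors -/

section GaussianVectors

variable {Ω : Type*} [MeasurableSpace Ω] {d : ℕ} {ι κ : Type*}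

/-- A centered Gaussian vector with covariance matrix `S`. -/
structure IsCenteredGaussian (μ : Measure Ω) (Z : Ω → ι → ℝ) (S : Matrix ι ι ℝ) : Prop where
  measurable : Measurable Z
  gaussian : HasGaussianLaw Z μ
  mean_zero : ∀ i, ∫ ω, Z ω i ∂μ = 0
  cov_eq : ∀ i j, cov[fun ω => Z ω i, fun ω => Z ω j; μ] = S i j

/-- The vector `b` has independent entries `b j ∼ N(m j, v j)`, and is independent of `ξ`. -/
structure IsGaussianSplit (μ : Measure Ω) (ξ b : Ω → Fin d → ℝ) (m : Fin d → ℝ)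
    (v : Fin d → ℝ≥0) : Prop where
  measurable_left : Measurable ξ
  measurable_right : Measurable b
  law : ∀ j, HasLaw (fun ω => b ω j) (gaussianReal (m j) (v j)) μ
  indep_entries : iIndepFun (fun j ω => b ω j) μ
  indep : IndepFun ξ b μ

theorem continuous_mulVec [Fintype ι] (A : Matrix κ ι ℝ) : Continuous fun z : ι → ℝ => A *ᵥ z :=
  A.mulVecLin.continuous_of_finiteDimensional

theorem IsCenteredGaussian.memLp {μ : Measure Ω} {Z : Ω → ι → ℝ} {S : Matrix ι ι ℝ}
    (h : IsCenteredGaussian μ Z S) (i : ι) : MemLp (fun ω => Z ω i) 2 μ :=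
  (h.gaussian.eval (X := fun i ω => Z ω i) i).memLp_two

theorem IsCenteredGaussian.cov_mulVec [Fintype ι] {μ : Measure Ω} [IsProbabilityMeasure μ] {Z : Ω → ι → ℝ}
    {S : Matrix ι ι ℝ} (h : IsCenteredGaussian μ Z S) {κ' : Type*} (A : Matrix κ ι ℝ)
    (B : Matrix κ' ι ℝ) (i : κ) (j : κ') :
    cov[fun ω => (A *ᵥ Z ω) i, fun ω => (B *ᵥ Z ω) j; μ] = (A * S * Bᵀ) i j := by
  simp only [Matrix.mulVec, dotProduct]
  rw [covariance_fun_sum_fun_sum (fun l => (h.memLp l).const_mul _)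
    (fun l => (h.memLp l).const_mul _)]
  simp only [covariance_const_mul_left, covariance_const_mul_right, h.cov_eq, Matrix.mul_apply,
    Matrix.transpose_apply, Finset.sum_mul]
  rw [Finset.sum_comm]
  exact Finset.sum_congr rfl fun _ _ => Finset.sum_congr rfl fun _ _ => by ring

theorem IsCenteredGaussian.mulVec [Fintype ι] [Fintype κ] {μ : Measure Ω} [IsProbabilityMeasure μ] {Z : Ω → ι → ℝ}
    {S : Matrix ι ι ℝ} (h : IsCenteredGaussian μ Z S) (A : Matrix κ ι ℝ) :
    IsCenteredGaussian μ (fun ω => A *ᵥ Z ω) (A * S * Aᵀ) where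
  measurable := (continuous_mulVec A).measurable.comp h.measurable
  gaussian := h.gaussian.map_fun A.mulVecLin.toContinuousLinearMap
  mean_zero i := by
    simp only [Matrix.mulVec, dotProduct]
    rw [integral_finsetSum _ fun l _ =>
      ((h.memLp l).integrable (by norm_num)).const_mul _]
    simp [integral_const_mul, h.mean_zero]
  cov_eq i j := h.cov_mulVec A A i j

theorem IsCenteredGaussian.sumElim [Fintype ι] [Fintype κ] {μ : Measure Ω} [IsProbabilityMeasure μ] {Z : Ω → ι → ℝ}
    {Z' : Ω → κ → ℝ} {S : Matrix ι ι ℝ} {S' : Matrix κ κ ℝ} (h : IsCenteredGaussian μ Z S)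
    (h' : IsCenteredGaussian μ Z' S') (hind : IndepFun Z Z' μ) :
    IsCenteredGaussian μ (fun ω => Sum.elim (Z ω) (Z' ω)) (Matrix.fromBlocks S 0 0 S') where
  measurable := measurable_pi_lambda _ fun i => by
    cases i
    · exact (measurable_pi_apply _).comp h.measurable
    · exact (measurable_pi_apply _).comp h'.measurable
  gaussian := (hind.hasGaussianLaw h.gaussian h'.gaussian).map_fun
    (LinearEquiv.sumArrowLequivProdArrow ι κ ℝ ℝ).symm.toLinearMap.toContinuousLinearMap
  mean_zero i := by
    cases i
    · exact h.mean_zero _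
    · exact h'.mean_zero _
  cov_eq i j := by
    have h0 : ∀ (i : ι) (j : κ), cov[fun ω => Z ω i, fun ω => Z' ω j; μ] = 0 := fun i j =>
      (hind.comp (measurable_pi_apply i) (measurable_pi_apply j)).covariance_eq_zero
        (h.memLp i) (h'.memLp j)
    cases i <;> cases j
    · exact h.cov_eq _ _
    · simpa using h0 _ _
    · simpa using (covariance_comm _ _).trans (h0 _ _)
    · exact h'.cov_eq _ _

/-- Both images are linear in one Gaussian vector, so they are jointly Gaussian and vanishing
covariances give independence. Each formulation then only needs two matrix identities. -/
theorem IsCenteredGaussian.isGaussianSplit [Fintype ι] {μ : Measure Ω} [IsProbabilityMeasure μ]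
    {Z : Ω → ι → ℝ} {S : Matrix ι ι ℝ} (h : IsCenteredGaussian μ Z S)
    (A B : Matrix (Fin d) ι ℝ) (c m v : Fin d → ℝ)
    (hBA : B * S * Aᵀ = 0) (hAA : A * S * Aᵀ = Matrix.diagonal v) :
    IsGaussianSplit μ (fun ω => c + B *ᵥ Z ω) (fun ω => m + A *ᵥ Z ω) m
      (fun j => (v j).toNNReal) := by
  have hA := h.mulVec A
  have hB := h.mulVec B
  have hadd : ∀ c : Fin d → ℝ, Measurable fun z : Fin d → ℝ => c + z := fun c =>
    measurable_const_add c
  refine ⟨(hadd c).comp hB.measurable, (hadd m).comp hA.measurable, fun j => ?_, ?_, ?_⟩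
  · have hg := hA.gaussian.eval (X := fun j ω => (A *ᵥ Z ω) j) j
    have hlaw : HasLaw (fun ω => (A *ᵥ Z ω) j) (gaussianReal 0 (v j).toNNReal) μ := by
      refine ⟨hg.aemeasurable, ?_⟩
      rw [hg.map_eq_gaussianReal, hA.mean_zero, ← covariance_self hg.aemeasurable, hA.cov_eq, hAA,
        Matrix.diagonal_apply_eq]
    have := gaussianReal_const_add hlaw (m j)
    rwa [zero_add] at this
  · have : iIndepFun (fun j ω => (A *ᵥ Z ω) j) μ := by
      refine HasGaussianLaw.iIndepFun_of_covariance_eq_zero hA.gaussian fun i j hij => ?_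
      rw [hA.cov_eq, hAA, Matrix.diagonal_apply_ne _ hij]
    exact this.comp (fun j x => m j + x) fun j => measurable_const_add _
  · have : IndepFun (fun ω => B *ᵥ Z ω) (fun ω => A *ᵥ Z ω) μ := by
      refine HasGaussianLaw.indepFun_of_covariance_eval (X := fun i ω => (B *ᵥ Z ω) i)
        (Y := fun i ω => (A *ᵥ Z ω) i) ?_ fun i j => ?_
      · exact h.gaussian.map_fun (B.mulVecLin.prod A.mulVecLin).toContinuousLinearMap
      · rw [h.cov_mulVec, hBA, Matrix.zero_apply]
    exact this.comp (hadd c) (hadd m)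

theorem IsCenteredGaussian.of_multivariateGaussian {μ : Measure Ω} {w : Ω → Fin d → ℝ}
    {S : Matrix (Fin d) (Fin d) ℝ} (hS : S.PosSemidef) (hw : Measurable w)
    (hlaw : HasLaw (fun ω => WithLp.toLp 2 (w ω)) (multivariateGaussian 0 S) μ) :
    IsCenteredGaussian μ w S where
  measurable := hw
  gaussian := hlaw.hasGaussianLaw.map_fun
    (PiLp.continuousLinearEquiv 2 ℝ (fun _ : Fin d => ℝ)).toContinuousLinearMap
  mean_zero i := by
    have h1 := hlaw.integral_comp (f := fun x => x i) (by fun_prop)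
    have h2 := (EuclideanSpace.proj (𝕜 := ℝ) i :
      EuclideanSpace ℝ (Fin d) →L[ℝ] ℝ).integral_comp_comm
        (IsGaussian.integrable_fun_id (μ := multivariateGaussian (0 : EuclideanSpace ℝ (Fin d)) S))
    refine h1.trans (h2.trans ?_)
    simp
  cov_eq i j := by
    rw [← covariance_eval_multivariateGaussian (μ := 0) hS i j]
    exact hlaw.covariance_fun_comp (f := fun x => x i) (g := fun x => x j)
      (by fun_prop) (by fun_prop)

end GaussianVectors

/-! ### The Gaussian structure of knockoff procedures -/

variable {Ω : Type*} [MeasurableSpace Ω] {n d : ℕ} {μ : Measure Ω}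
  {X : Matrix (Fin n) (Fin d) ℝ} {β : Fin d → ℝ} {σ : ℝ} {y : Ω → Fin n → ℝ}

theorem IsGaussianLinearModel.law_errors' (h : IsGaussianLinearModel μ X β σ y) (i : Fin n) :
    HasLaw (fun ω => y ω i - (X *ᵥ β) i) (gaussianReal 0 (σ ^ 2).toNNReal) μ := by
  rw [Real.toNNReal_of_nonneg (sq_nonneg σ)]
  exact h.law_errors i

theorem IsGaussianLinearModel.isCenteredGaussian (h : IsGaussianLinearModel μ X β σ y) :
    IsCenteredGaussian μ (fun ω => y ω - X *ᵥ β) (σ ^ 2 • (1 : Matrix (Fin n) (Fin n) ℝ)) where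
  measurable := h.measurable_response.sub_const _
  gaussian := h.indep_errors.hasGaussianLaw fun i => (h.law_errors' i).hasGaussianLaw
  mean_zero i := by
    have := (h.law_errors' i).integral_eq
    rw [integral_id_gaussianReal] at this
    exact this
  cov_eq i j := by
    have hm : ∀ i, MemLp (fun ω => y ω i - (X *ᵥ β) i) 2 μ := fun i =>
      (h.law_errors' i).hasGaussianLaw.memLp_two
    rcases eq_or_ne i j with rfl | hij
    · have h1 := (h.law_errors' i).variance_eq
      rw [variance_id_gaussianReal] at h1
      rw [Matrix.smul_apply, Matrix.one_apply_eq, smul_eq_mul, mul_one]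
      rw [Real.coe_toNNReal _ (sq_nonneg σ)] at h1
      exact (covariance_self (hm i).aemeasurable).trans h1
    · rw [Matrix.smul_apply, Matrix.one_apply_ne hij, smul_zero]
      exact (h.indep_errors.indepFun hij).covariance_eq_zero (hm i) (hm j)

theorem IsGaussianLinearModel.posDef_gram (h : IsGaussianLinearModel μ X β σ y) :
    (Xᵀ * X).PosDef := by
  have := Matrix.PosDef.conjTranspose_mul_self X (Matrix.mulVec_injective_iff.2 h.full_column_rank)
  simpa using this

theorem IsGaussianLinearModel.isUnit_gram (h : IsGaussianLinearModel μ X β σ y) :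
    IsUnit (Xᵀ * X).det := (Matrix.isUnit_iff_isUnit_det _).1 h.posDef_gram.isUnit

theorem IsGaussianLinearModel.olsCov_mul_gram (h : IsGaussianLinearModel μ X β σ y) :
    olsCov X * (Xᵀ * X) = 1 := Matrix.nonsing_inv_mul _ h.isUnit_gram

theorem IsGaussianLinearModel.ols_eq (h : IsGaussianLinearModel μ X β σ y) (z : Fin n → ℝ) :
    ols X z = β + (olsCov X * Xᵀ) *ᵥ (z - X *ᵥ β) := by
  rw [Matrix.mulVec_sub, Matrix.mulVec_mulVec, Matrix.mul_assoc, h.olsCov_mul_gram,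
    Matrix.one_mulVec, ols, Matrix.mulVec_mulVec]
  abel

theorem IsGaussianLinearModel.xi_eq (h : IsGaussianLinearModel μ X β σ y) {Δ : Fin d → ℝ}
    (hΔ : ∀ j, 0 < Δ j) (z : Fin n → ℝ) (b : Fin d → ℝ) :
    xi X Δ z b = Xᵀ *ᵥ z - Matrix.diagonal (fun j => (Δ j)⁻¹) *ᵥ b := by
  have hd : (Matrix.diagonal Δ)⁻¹ = Matrix.diagonal fun j => (Δ j)⁻¹ := by
    refine Matrix.inv_eq_left_inv ?_
    rw [Matrix.diagonal_mul_diagonal, ← Matrix.diagonal_one]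
    congr 1
    ext j
    exact inv_mul_cancel₀ (hΔ j).ne'
  rw [xi, hd, ols, Matrix.mulVec_mulVec, olsCov, Matrix.nonsing_inv_nonsing_inv _ h.isUnit_gram,
    Matrix.mul_nonsing_inv _ h.isUnit_gram, Matrix.one_mulVec]

/-- With `u` the centered OLS estimator, the centered `βt` is `u + w` and the centered `ξ` is `(Σ⁻¹
- Δ⁻¹) u - Δ⁻¹ w`. Their covariance is `σ²` times `(1 - Δ⁻¹ Σ) - Δ⁻¹ (Δ - Σ) = 0`, and `u + w` has
covariance `σ² Δ`. -/
theorem IsGaussianLinearModel.whitening_split [IsProbabilityMeasure μ]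
    (h : IsGaussianLinearModel μ X β σ y)
    {Δ : Fin d → ℝ} {w : Ω → Fin d → ℝ} (dominates : (Matrix.diagonal Δ - olsCov X).PosSemidef)
    (measurable_noise : Measurable w)
    (law_noise : HasLaw (fun ω => WithLp.toLp 2 (w ω))
      (multivariateGaussian 0 (σ ^ 2 • (Matrix.diagonal Δ - olsCov X))) μ)
    (indep_noise : IndepFun w (fun ω => ols X (y ω)) μ) :
    (∀ j, 0 < Δ j) ∧ IsGaussianSplit μ (fun ω => xi X Δ (y ω) (ols X (y ω) + w ω))
      (fun ω => ols X (y ω) + w ω) β (fun j => (σ ^ 2 * Δ j).toNNReal) := by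
  have hcov : (olsCov X).PosDef := h.posDef_gram.inv
  have hΔ : ∀ j, 0 < Δ j := fun j => by
    have h1 := dominates.diag_nonneg (i := j)
    have h2 := hcov.diag_pos (i := j)
    simp only [Matrix.sub_apply, Matrix.diagonal_apply_eq] at h1
    linarith
  refine ⟨hΔ, ?_⟩
  have hS : (σ ^ 2 • (Matrix.diagonal Δ - olsCov X)).PosSemidef := dominates.smul (sq_nonneg σ)
  set u : Ω → Fin d → ℝ := fun ω => (olsCov X * Xᵀ) *ᵥ (y ω - X *ᵥ β) with hu
  have hucov : olsCov X * Xᵀ * (σ ^ 2 • (1 : Matrix (Fin n) (Fin n) ℝ)) * (olsCov X * Xᵀ)ᵀ =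
      σ ^ 2 • olsCov X := by
    have hsym : (olsCov X)ᵀ = olsCov X := hcov.isHermitian
    rw [Matrix.transpose_mul, Matrix.transpose_transpose, hsym, Matrix.mul_smul, Matrix.smul_mul,
      Matrix.mul_one, Matrix.mul_assoc, ← Matrix.mul_assoc Xᵀ, ← Matrix.mul_assoc (olsCov X),
      h.olsCov_mul_gram, Matrix.one_mul]
  have huG : IsCenteredGaussian μ u (σ ^ 2 • olsCov X) := by
    rw [← hucov]; exact h.isCenteredGaussian.mulVec _
  have hwG : IsCenteredGaussian μ w (σ ^ 2 • (Matrix.diagonal Δ - olsCov X)) :=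
    .of_multivariateGaussian hS measurable_noise law_noise
  have huw : IndepFun u w μ := by
    have h1 : u = (fun z : Fin d → ℝ => z - β) ∘ fun ω => ols X (y ω) := by
      ext1 ω
      simp [hu, h.ols_eq]
    rw [h1]
    exact indep_noise.symm.comp (measurable_id.sub_const β) measurable_id
  have hZ := huG.sumElim hwG huw
  set P := olsCov X with hP
  set Di := Matrix.diagonal (fun j => (Δ j)⁻¹) with hDi
  have hDiD : Di * Matrix.diagonal Δ = 1 := by
    rw [hDi, Matrix.diagonal_mul_diagonal, ← Matrix.diagonal_one]
    congr 1
    ext j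
    exact inv_mul_cancel₀ (hΔ j).ne'
  have hPi : Xᵀ * X * P = 1 := Matrix.mul_nonsing_inv _ h.isUnit_gram
  have hsplit := hZ.isGaussianSplit (Matrix.fromCols 1 1) (Matrix.fromCols (Xᵀ * X - Di) (-Di))
    (Xᵀ *ᵥ (X *ᵥ β) - Di *ᵥ β) β (fun j => σ ^ 2 * Δ j)
    (by
      rw [Matrix.fromCols_mul_fromBlocks, Matrix.transpose_fromCols, Matrix.fromCols_mul_fromRows]
      simp only [Matrix.mul_zero, Matrix.mul_smul, add_zero, zero_add, Matrix.transpose_one,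
        Matrix.mul_one, Matrix.sub_mul, Matrix.mul_sub, Matrix.neg_mul, hPi, hDiD]
      rw [← smul_add]
      simp)
    (by
      rw [Matrix.fromCols_mul_fromBlocks, Matrix.transpose_fromCols, Matrix.fromCols_mul_fromRows]
      simp only [Matrix.mul_zero, Matrix.one_mul, add_zero, zero_add, Matrix.transpose_one,
        Matrix.mul_one]
      rw [← smul_add, add_sub_cancel, ← Matrix.diagonal_smul]
      rfl)
  have e1 : ∀ ω, ols X (y ω) + w ω = β + (Matrix.fromCols 1 1 *ᵥ Sum.elim (u ω) (w ω)) := by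
    intro ω
    rw [h.ols_eq, Matrix.fromCols_mulVec_sumElim, Matrix.one_mulVec, Matrix.one_mulVec, add_assoc]
  have e2 : ∀ ω, xi X Δ (y ω) (ols X (y ω) + w ω) = Xᵀ *ᵥ (X *ᵥ β) - Di *ᵥ β +
      (Matrix.fromCols (Xᵀ * X - Di) (-Di)) *ᵥ Sum.elim (u ω) (w ω) := by
    intro ω
    have e3 : (Xᵀ * X) *ᵥ u ω = Xᵀ *ᵥ (y ω) - Xᵀ *ᵥ (X *ᵥ β) := by
      simp only [hu]
      rw [Matrix.mulVec_mulVec, ← Matrix.mul_assoc, hPi, Matrix.one_mul, Matrix.mulVec_sub]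
    rw [h.xi_eq hΔ, e1, Matrix.fromCols_mulVec_sumElim, Matrix.fromCols_mulVec_sumElim,
      Matrix.sub_mulVec, e3, Matrix.one_mulVec, Matrix.one_mulVec, Matrix.neg_mulVec,
      Matrix.mulVec_add, Matrix.mulVec_add]
    abel
  rw [funext e2, funext e1]
  exact hsplit

/-! ### Sums and differences of the design and its knockoff. -/

theorem transpose_sub_mul_sub {Xt : Matrix (Fin n) (Fin d) ℝ} {D : Fin d → ℝ}
    (gram : Xtᵀ * Xt = Xᵀ * X) (cross : Xtᵀ * X = Xᵀ * X - Matrix.diagonal D) :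
    (X - Xt)ᵀ * (X - Xt) = (2 : ℝ) • Matrix.diagonal D := by
  have cross' : Xᵀ * Xt = Xᵀ * X - Matrix.diagonal D := by
    simpa [Matrix.transpose_mul] using congrArg Matrix.transpose cross
  rw [Matrix.transpose_sub, Matrix.sub_mul, Matrix.mul_sub, Matrix.mul_sub, gram, cross, cross',
    two_smul]
  abel

theorem transpose_add_mul_sub {Xt : Matrix (Fin n) (Fin d) ℝ} {D : Fin d → ℝ}
    (gram : Xtᵀ * Xt = Xᵀ * X) (cross : Xtᵀ * X = Xᵀ * X - Matrix.diagonal D) :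
    (X + Xt)ᵀ * (X - Xt) = 0 := by
  have cross' : Xᵀ * Xt = Xᵀ * X - Matrix.diagonal D := by
    simpa [Matrix.transpose_mul] using congrArg Matrix.transpose cross
  rw [Matrix.transpose_add, Matrix.add_mul, Matrix.mul_sub, Matrix.mul_sub, gram, cross, cross']
  abel

theorem IsGaussianLinearModel.xi_standard (h : IsGaussianLinearModel μ X β σ y)
    (Xt : Matrix (Fin n) (Fin d) ℝ) {D : Fin d → ℝ} (pos : ∀ j, 0 < D j) (z : Fin n → ℝ) :
    xi X (fun j => 2 / D j) z (fun j => (D j)⁻¹ * ((X - Xt)ᵀ *ᵥ z) j) =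
      ((2 : ℝ)⁻¹ • (X + Xt)ᵀ) *ᵥ z := by
  rw [h.xi_eq fun j => div_pos two_pos (pos j)]
  ext j
  have := (pos j).ne'
  rw [Pi.sub_apply, Matrix.mulVec_diagonal, Matrix.smul_mulVec, Matrix.transpose_add,
    Matrix.transpose_sub, Matrix.add_mulVec, Matrix.sub_mulVec, Pi.smul_apply, Pi.add_apply,
    Pi.sub_apply, smul_eq_mul]
  field_simp
  ring

/-- Here `ξ` comes from `(X + Xt)ᵀ y` and `βt` from `(X - Xt)ᵀ y`. The columns of the sum and of the
difference are orthogonal, and the differences have Gram matrix `2 D`. -/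
theorem IsGaussianLinearModel.standard_split [IsProbabilityMeasure μ]
    (h : IsGaussianLinearModel μ X β σ y)
    {Xt : Matrix (Fin n) (Fin d) ℝ} {D : Fin d → ℝ} (pos : ∀ j, 0 < D j)
    (gram : Xtᵀ * Xt = Xᵀ * X) (cross : Xtᵀ * X = Xᵀ * X - Matrix.diagonal D) :
    IsGaussianSplit μ
      (fun ω => xi X (fun j => 2 / D j) (y ω) fun j => (D j)⁻¹ * ((X - Xt)ᵀ *ᵥ y ω) j)
      (fun ω j => (D j)⁻¹ * ((X - Xt)ᵀ *ᵥ y ω) j) β (fun j => (σ ^ 2 * (2 / D j)).toNNReal) := by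
  set Di := Matrix.diagonal fun j => (D j)⁻¹ with hDi
  have hDiD : Di * Matrix.diagonal D = 1 := by
    rw [hDi, Matrix.diagonal_mul_diagonal, ← Matrix.diagonal_one]
    congr 1
    ext j
    exact inv_mul_cancel₀ (pos j).ne'
  have hDit : Diᵀ = Di := Matrix.diagonal_transpose _
  have hdiff := transpose_sub_mul_sub gram cross
  have horth := transpose_add_mul_sub gram cross
  have hb : ∀ ω, (fun j => (D j)⁻¹ * ((X - Xt)ᵀ *ᵥ y ω) j) =
      β + (Di * (X - Xt)ᵀ) *ᵥ (y ω - X *ᵥ β) := by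
    intro ω
    have e1 : Di * (X - Xt)ᵀ * X = 1 := by
      rw [Matrix.mul_assoc, Matrix.transpose_sub, Matrix.sub_mul, cross, sub_sub_cancel, hDiD]
    rw [Matrix.mulVec_sub, Matrix.mulVec_mulVec, e1, Matrix.one_mulVec, add_sub_cancel,
      ← Matrix.mulVec_mulVec]
    ext j
    rw [hDi, Matrix.mulVec_diagonal]
  have hx : ∀ ω, xi X (fun j => 2 / D j) (y ω) (fun j => (D j)⁻¹ * ((X - Xt)ᵀ *ᵥ y ω) j) =
      ((2 : ℝ)⁻¹ • (X + Xt)ᵀ) *ᵥ (X *ᵥ β) +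
        ((2 : ℝ)⁻¹ • (X + Xt)ᵀ) *ᵥ (y ω - X *ᵥ β) := by
    intro ω
    rw [h.xi_standard Xt pos, ← Matrix.mulVec_add, add_sub_cancel]
  have hsplit := h.isCenteredGaussian.isGaussianSplit (Di * (X - Xt)ᵀ)
    ((2 : ℝ)⁻¹ • (X + Xt)ᵀ) (((2 : ℝ)⁻¹ • (X + Xt)ᵀ) *ᵥ (X *ᵥ β)) β
    (fun j => σ ^ 2 * (2 / D j))
    (by
      rw [Matrix.transpose_mul, Matrix.transpose_transpose, Matrix.mul_smul, Matrix.mul_one,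
        Matrix.smul_mul, Matrix.smul_mul, ← Matrix.mul_assoc, horth, Matrix.zero_mul, smul_zero,
        smul_zero])
    (by
      rw [Matrix.transpose_mul, Matrix.transpose_transpose, Matrix.mul_smul, Matrix.mul_one,
        Matrix.smul_mul, Matrix.mul_assoc, ← Matrix.mul_assoc (X - Xt)ᵀ, hdiff, hDit,
        Matrix.smul_mul, Matrix.mul_smul, ← Matrix.mul_assoc, hDiD, Matrix.one_mul, hDi,
        ← Matrix.diagonal_smul, ← Matrix.diagonal_smul]
      congr 1)
  rw [funext hx, funext hb]
  exact hsplit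

end

section

/-! ### Both formulations are sequential selection rules -/

variable {n d : ℕ}

/-- The real signs `±1` encoded by a Boolean vector. -/
def signVec (s : Fin d → Bool) (j : Fin d) : ℝ := if s j then 1 else -1

theorem sign_eq_signVec {b : Fin d → ℝ} {j : Fin d} (hb : b j ≠ 0) :
    Real.sign (b j) = signVec (signs b) j := by
  unfold signVec signs
  rcases lt_or_gt_of_ne hb with h | h
  · rw [Real.sign_of_neg h]; simp [h.not_gt]
  · rw [Real.sign_of_pos h]; simp [h]

theorem sign_signVec (s : Fin d → Bool) (j : Fin d) : Real.sign (signVec s j) = signVec s j := by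
  unfold signVec
  split_ifs
  · exact Real.sign_of_pos one_pos
  · exact Real.sign_of_neg (by norm_num)

theorem add_one_le_mul_of_div_le {Z A : ℕ} {α : ℝ} (hα : 0 < α)
    (h : (1 + (Z : ℝ≥0∞)) / (A : ℝ≥0∞) ≤ ENNReal.ofReal α) : (Z : ℝ) + 1 ≤ α * A := by
  rcases Nat.eq_zero_or_pos A with rfl | hA
  · rw [Nat.cast_zero, ENNReal.div_zero (by simp)] at h
    exact absurd h (by simp)
  · rw [ENNReal.div_le_iff (by simpa using hA.ne') (ENNReal.natCast_ne_top A)] at h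
    have h1 := ENNReal.toReal_mono
      (ENNReal.mul_ne_top ENNReal.ofReal_ne_top (ENNReal.natCast_ne_top A)) h
    rw [ENNReal.toReal_mul, ENNReal.toReal_ofReal hα.le, ENNReal.toReal_natCast,
      ENNReal.toReal_add (by simp) (ENNReal.natCast_ne_top Z)] at h1
    simp only [ENNReal.toReal_one, ENNReal.toReal_natCast] at h1
    linarith

theorem isSequential_seqStep {α : ℝ} (hα : 0 < α) (ψ : Fin d → ℝ)
    (hψ : ∀ j, ψ j = 1 ∨ ψ j = -1) (π : Equiv.Perm (Fin d)) :
    IsSequential α fun s => seqStep (pValue (signVec s) ψ) π α := by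
  classical
  refine ⟨π, fun j => decide (ψ j = 1), fun s => ?_⟩
  set p := pValue (signVec s) ψ with hp
  change seqStep p π α = ∅ ∨ ∃ l : ℕ,
    seqStep p π α = Finset.univ.filter
      (fun j => (π.symm j : ℕ) < l ∧ s j = decide (ψ j = 1)) ∧
    ((Finset.univ.filter
      (fun j => (π.symm j : ℕ) < l ∧ s j ≠ decide (ψ j = 1))).card : ℝ) + 1
        ≤ α * (seqStep p π α).card
  have hsgn : ∀ j, signVec s j = ψ j ↔ s j = decide (ψ j = 1) := by
    intro j
    unfold signVec
    rcases hψ j with h | h <;> cases hs : s j <;> rw [h] <;> norm_num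
  have hhalf : ∀ j, p j = 1 / 2 ↔ s j = decide (ψ j = 1) := by
    intro j
    rw [hp, pValue, sign_signVec, ← hsgn]
    split_ifs with h <;> simp [h]
  have hone : ∀ j, p j = 1 ↔ s j ≠ decide (ψ j = 1) := by
    intro j
    rw [hp, pValue, sign_signVec, Ne, ← hsgn]
    split_ifs with h <;> simp [h]
  set T := (Finset.range (d + 1)).filter (fun k => fdpWh p π k ≤ ENNReal.ofReal α) with hT
  have hk : kHat p π α = T.sup id := rfl
  have hstep : seqStep p π α = Finset.univ.filter
      (fun j => (π.symm j : ℕ) < kHat p π α ∧ s j = decide (ψ j = 1)) := by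
    ext j
    simp only [seqStep, Finset.mem_filter, Finset.mem_univ, true_and, hhalf]
  rcases T.eq_empty_or_nonempty with h | h
  · left
    rw [hstep, hk, h]
    simp
  · right
    obtain ⟨k, hkT, hkeq⟩ := Finset.exists_mem_eq_sup T h id
    refine ⟨kHat p π α, hstep, ?_⟩
    have hfdp : fdpWh p π (kHat p π α) ≤ ENNReal.ofReal α := by
      rw [hk, hkeq]
      exact (Finset.mem_filter.1 hkT).2
    refine (le_of_eq ?_).trans ((add_one_le_mul_of_div_le hα hfdp).trans (le_of_eq ?_))
    · congr 2
      refine Finset.card_equiv π.symm fun j => ?_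
      simp [hone]
    · congr 2
      rw [hstep]
      refine Finset.card_equiv π fun j => ?_
      simp only [Finset.mem_filter, Finset.mem_univ, true_and, hhalf, Equiv.symm_apply_apply]

/-- Lying above the least admissible threshold means lying above some admissible one. This form
displays the event as a finite union, as needed for measurability. -/
theorem mem_knockoffFilter {W : Fin d → ℝ} {α : ℝ} {j : Fin d} :
    j ∈ knockoffFilter W α ↔
      ∃ i, 0 < |W i| ∧ fdpKn W |W i| ≤ ENNReal.ofReal α ∧ |W i| ≤ W j := by
  classical
  simp only [knockoffFilter, Finset.mem_filter, Finset.mem_univ, true_and]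
  constructor
  · intro h
    have hne : (thresholds W α).min ≠ ⊤ := fun h' => by simp [h'] at h
    obtain ⟨t, ht⟩ := WithTop.ne_top_iff_exists.1 hne
    have hmem := Finset.mem_of_min ht.symm
    rw [← ht, WithTop.coe_le_coe] at h
    simp only [thresholds, Finset.mem_filter, Finset.mem_image, Finset.mem_univ, true_and] at hmem
    obtain ⟨⟨i, rfl⟩, h0, h1⟩ := hmem
    exact ⟨i, h0, h1, h⟩
  · rintro ⟨i, h0, h1, h2⟩
    have : |W i| ∈ thresholds W α := by
      simp only [thresholds, Finset.mem_filter, Finset.mem_image, Finset.mem_univ, true_and]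
      exact ⟨⟨i, rfl⟩, h0, h1⟩
    exact (Finset.min_le this).trans (WithTop.coe_le_coe.2 h2)

/-- Sublevel sets are initial segments of the sorted order, however ties are broken. -/
theorem sort_symm_lt_iff (f : Fin d → ℝ) (a : ℝ) (j : Fin d) [DecidablePred fun j => f j ≤ a] :
    ((Tuple.sort f).symm j : ℕ) < (Finset.univ.filter fun j => f j ≤ a).card ↔ f j ≤ a := by
  classical
  have h := Tuple.lt_card_le_iff_apply_le_of_monotone (j := (Tuple.sort f).symm j) (a := a)
    (Tuple.monotone_sort f)
  rw [Function.comp_apply, Equiv.apply_symm_apply] at h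
  rw [← h]
  have : (Finset.univ.filter fun j => f j ≤ a).card =
      (Finset.univ.filter fun i => (f ∘ Tuple.sort f) i ≤ a).card :=
    Finset.card_equiv (Tuple.sort f).symm fun i => by simp
  rw [this]

theorem card_le_of_kthLargest_lt {x : Fin d → ℝ} {k : ℕ} (hk : 1 ≤ k) (hkd : k ≤ d) {a : ℝ}
    (h : kthLargest x k < a) [DecidablePred fun j => a ≤ x j] :
    (Finset.univ.filter fun j => a ≤ x j).card < k := by
  classical
  rw [kthLargest, dif_pos ⟨hk, hkd⟩] at h
  set i : Fin d := ⟨k - 1, by omega⟩ with hi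
  have h1 := sort_symm_lt_iff (fun j => -x j) (-a) (Tuple.sort (fun j => -x j) i)
  rw [Equiv.symm_apply_apply] at h1
  simp only [neg_le_neg_iff] at h1
  have h2 := mt h1.1 (not_le.2 h)
  have h3 : (i : ℕ) = k - 1 := rfl
  omega

/-- Sorting by decreasing `|g j|` and taking the sign of `g j` as direction, a threshold `t > 0`
cuts out the segment `|g j| ≥ t`. In it, matches are `W j ≥ t` and mismatches are `W j ≤ -t`.
Entries with `g j = 0` never enter it. -/
theorem isSequential_knockoffFilter {α : ℝ} (hα : 0 < α) (g : Fin d → ℝ) :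
    IsSequential α fun s => knockoffFilter (fun j => signVec s j * g j) α := by
  classical
  refine ⟨Tuple.sort fun j => -|g j|, fun j => decide (0 < g j), fun s => ?_⟩
  set W : Fin d → ℝ := fun j => signVec s j * g j with hW
  change knockoffFilter W α = ∅ ∨ ∃ l : ℕ,
    knockoffFilter W α = Finset.univ.filter
      (fun j => ((Tuple.sort fun j => -|g j|).symm j : ℕ) < l ∧ s j = decide (0 < g j)) ∧
    ((Finset.univ.filter (fun j =>
      ((Tuple.sort fun j => -|g j|).symm j : ℕ) < l ∧ s j ≠ decide (0 < g j))).card : ℝ) + 1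
        ≤ α * (knockoffFilter W α).card
  rcases hmin : (thresholds W α).min with _ | t
  · left
    have hmin : (thresholds W α).min = ⊤ := hmin
    simp [knockoffFilter, hmin]
  right
  have hmin : (thresholds W α).min = (t : WithTop ℝ) := hmin
  have ht := Finset.mem_of_min hmin
  simp only [thresholds, Finset.mem_filter] at ht
  obtain ⟨-, ht0, hfdp⟩ := ht
  have hsort : ∀ j, ((Tuple.sort fun j => -|g j|).symm j : ℕ) <
      (Finset.univ.filter fun j => -|g j| ≤ -t).card ↔ t ≤ |g j| := fun j => by
    rw [sort_symm_lt_iff, neg_le_neg_iff]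
  have hpos : ∀ j, t ≤ W j ↔ t ≤ |g j| ∧ s j = decide (0 < g j) := by
    intro j
    simp only [hW, signVec]
    rcases lt_trichotomy (g j) 0 with h | h | h
    · cases hs : s j
      · simp [abs_of_neg h, h.not_gt]
      · simp [h.not_gt]; linarith
    · simp [h, ht0]
    · cases hs : s j
      · simp [h]; linarith
      · simp [abs_of_pos h, h]
  have hneg : ∀ j, W j ≤ -t ↔ t ≤ |g j| ∧ s j ≠ decide (0 < g j) := by
    intro j
    simp only [hW, signVec]
    rcases lt_trichotomy (g j) 0 with h | h | h
    · cases hs : s j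
      · simp [h.not_gt]; linarith
      · simp [abs_of_neg h, h.not_gt]; exact le_neg
    · simp [h, ht0]
    · cases hs : s j
      · simp [abs_of_pos h, h]
      · simp [h]; linarith
  have hF : knockoffFilter W α = Finset.univ.filter (fun j => t ≤ W j) := by
    ext j
    simp only [knockoffFilter, Finset.mem_filter, Finset.mem_univ, true_and, hmin,
      WithTop.coe_le_coe]
  refine ⟨(Finset.univ.filter fun j => -|g j| ≤ -t).card, ?_, ?_⟩
  · rw [hF]
    ext j
    simp only [Finset.mem_filter, Finset.mem_univ, true_and, hsort, hpos]
  · rw [hF]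
    simp only [hsort, ← hneg]
    exact add_one_le_mul_of_div_le hα hfdp

/-! ### Measurability of the number of rejections. -/

theorem measurable_card_knockoffFilter (α : ℝ) :
    Measurable fun W : Fin d → ℝ => ((knockoffFilter W α).card : ℝ) := by
  classical
  have hcard : ∀ (T : (Fin d → ℝ) → Finset (Fin d)) (_ : ∀ j, MeasurableSet {W | j ∈ T W}),
      Measurable fun W => (T W).card := by
    intro T hT
    have : (fun W => (T W).card) = fun W => ∑ j, if j ∈ T W then 1 else 0 := by
      ext W; simp
    rw [this]
    exact Finset.measurable_sum _ fun j _ => Measurable.ite (hT j) measurable_const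
      measurable_const
  have hco : ∀ i, Measurable fun W : Fin d → ℝ => W i := fun i => measurable_pi_apply i
  have habs : ∀ i, Measurable fun W : Fin d → ℝ => |W i| := fun i => measurable_norm.comp (hco i)
  have hfdp : ∀ i, Measurable fun W : Fin d → ℝ => fdpKn W |W i| := by
    intro i
    unfold fdpKn
    refine Measurable.div (Measurable.const_add ?_ 1) ?_
    · refine (measurable_of_countable (fun k : ℕ => (k : ℝ≥0∞))).comp
        (hcard (fun W => Finset.univ.filter fun j => W j ≤ -|W i|) fun j => ?_)
      simpa using measurableSet_le (hco j) (habs i).neg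
    · refine (measurable_of_countable (fun k : ℕ => (k : ℝ≥0∞))).comp
        (hcard (fun W => Finset.univ.filter fun j => |W i| ≤ W j) fun j => ?_)
      simpa using measurableSet_le (habs i) (hco j)
  refine (measurable_of_countable (fun k : ℕ => (k : ℝ))).comp (hcard _ fun j => ?_)
  simp only [mem_knockoffFilter]
  have : {W : Fin d → ℝ | ∃ i, 0 < |W i| ∧ fdpKn W |W i| ≤ ENNReal.ofReal α ∧ |W i| ≤ W j} =
      ⋃ i, {W | 0 < |W i|} ∩ ({W | fdpKn W |W i| ≤ ENNReal.ofReal α} ∩ {W | |W i| ≤ W j}) := by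
    ext; simp
  rw [this]
  exact MeasurableSet.iUnion fun i => (measurableSet_lt measurable_const (habs i)).inter
    ((measurableSet_le (hfdp i) measurable_const).inter (measurableSet_le (habs i) (hco j)))

theorem measurable_card_recipe (A : Recipe d) (s : Fin d → Bool) (α : ℝ) :
    Measurable fun e => ((seqStep (pValue (signVec s) (A.direction e)) (A.order e) α).card : ℝ) := by
  set ψ : (Fin d → ℝ) × (Fin d → ℝ) → Fin d → Bool := fun e j => decide (A.direction e j = 1)
    with hψ
  have hψm : Measurable ψ := by
    refine measurable_pi_lambda _ fun j => measurable_to_bool ?_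
    have : (fun e => ψ e j) ⁻¹' {true} = (fun e => A.direction e j) ⁻¹' {1} := by
      ext; simp [hψ]
    rw [this]
    exact ((measurable_pi_apply j).comp A.measurable_direction) (measurableSet_singleton 1)
  have hdir : ∀ e, A.direction e = fun j => if ψ e j then 1 else -1 := by
    intro e
    ext j
    rcases A.direction_eq e j with h | h <;> simp [hψ, h]
  let : MeasurableSpace (Equiv.Perm (Fin d)) := ⊤
  have hord : Measurable A.order := measurable_to_countable' fun π => A.measurableSet_order π
  -- The count factors through the order and the Boolean directions, which take finitely many
  -- values.
  have hcomp : (fun e => ((seqStep (pValue (signVec s) (A.direction e)) (A.order e) α).card : ℝ)) =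
      (fun q : Equiv.Perm (Fin d) × (Fin d → Bool) =>
        ((seqStep (pValue (signVec s) (fun j => if q.2 j then 1 else -1)) q.1 α).card : ℝ)) ∘
        fun e => (A.order e, ψ e) := by
    ext e
    simp only [Function.comp_apply, ← hdir]
  rw [hcomp]
  exact (measurable_of_finite _).comp (hord.prodMk hψm)

/-- `P` is a linear, hence measurable, choice of a response with given exploratory data, so that `W
∘ P` is measurable. -/
theorem exists_generalizedInverse {V V' : Type*} [AddCommGroup V] [Module ℝ V] [AddCommGroup V']
    [Module ℝ V'] (M : V →ₗ[ℝ] V') : ∃ P : V' →ₗ[ℝ] V, ∀ z, M (P (M z)) = M z := by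
  obtain ⟨r, hr⟩ := M.rangeRestrict.exists_rightInverse_of_surjective M.range_rangeRestrict
  obtain ⟨P, hP⟩ := LinearMap.exists_extend r
  refine ⟨P, fun z => ?_⟩
  have h1 : P (M z) = r ⟨M z, LinearMap.mem_range_self M z⟩ :=
    LinearMap.congr_fun hP ⟨M z, LinearMap.mem_range_self M z⟩
  have h2 := LinearMap.congr_fun hr ⟨M z, LinearMap.mem_range_self M z⟩
  rw [h1]
  exact congrArg Subtype.val h2

/-- A statistic with the unordered pair property is, up to the signs of the whitened estimator, a
measurable function of the exploratory data. -/
theorem UnorderedPairProperty.exists_factorization {X Xt : Matrix (Fin n) (Fin d) ℝ}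
    {W : (Fin n → ℝ) → Fin d → ℝ} (pairs : UnorderedPairProperty X Xt W) {D : Fin d → ℝ}
    (pos : ∀ j, 0 < D j) (gram : Xtᵀ * Xt = Xᵀ * X)
    (cross : Xtᵀ * X = Xᵀ * X - Matrix.diagonal D) (measurable_stat : Measurable W) :
    ∃ g : (Fin d → ℝ) × (Fin d → ℝ) → Fin d → ℝ, Measurable g ∧
      ∀ z : Fin n → ℝ, (∀ j, (D j)⁻¹ * ((X - Xt)ᵀ *ᵥ z) j ≠ 0) → ∀ j, W z j =
        Real.sign ((D j)⁻¹ * ((X - Xt)ᵀ *ᵥ z) j) *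
          g (((2 : ℝ)⁻¹ • (X + Xt)ᵀ) *ᵥ z, fun j => |(D j)⁻¹ * ((X - Xt)ᵀ *ᵥ z) j|) j := by
  set M : (Fin n → ℝ) →ₗ[ℝ] (Fin d → ℝ) × (Fin d → ℝ) :=
    ((2 : ℝ)⁻¹ • (X + Xt)ᵀ).mulVecLin.prod
      ((Matrix.diagonal fun j => (D j)⁻¹) * (X - Xt)ᵀ).mulVecLin with hM
  have hM1 : ∀ z, (M z).1 = ((2 : ℝ)⁻¹ • (X + Xt)ᵀ) *ᵥ z := fun z => rfl
  have hM2 : ∀ z j, (M z).2 j = (D j)⁻¹ * ((X - Xt)ᵀ *ᵥ z) j := fun z j => by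
    change (((Matrix.diagonal fun j => (D j)⁻¹) * (X - Xt)ᵀ) *ᵥ z) j = _
    rw [← Matrix.mulVec_mulVec, Matrix.mulVec_diagonal]
  obtain ⟨P, hP⟩ := exists_generalizedInverse M
  refine ⟨fun e => W (P e), measurable_stat.comp
    P.continuous_of_finiteDimensional.measurable, fun z hz j => ?_⟩
  set b : Fin d → ℝ := fun j => (D j)⁻¹ * ((X - Xt)ᵀ *ᵥ z) j with hb
  set e : (Fin d → ℝ) × (Fin d → ℝ) := (((2 : ℝ)⁻¹ • (X + Xt)ᵀ) *ᵥ z, fun j => |b j|) with he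
  -- Moving `z` along the columns of `X - Xt` leaves `ξ` unchanged and can replace `b` by `|b|`, so
  -- `(ξ, |b|)` is the data of an actual response.
  have hrange : M (z + (X - Xt) *ᵥ fun j => (|b j| - b j) / 2) = e := by
    refine Prod.ext ?_ (funext fun j => ?_)
    · rw [hM1, Matrix.mulVec_add, Matrix.mulVec_mulVec, Matrix.smul_mul,
        transpose_add_mul_sub gram cross, smul_zero, Matrix.zero_mulVec, add_zero]
    · rw [hM2, Matrix.mulVec_add, Matrix.mulVec_mulVec, transpose_sub_mul_sub gram cross,
        Pi.add_apply, mul_add, Matrix.smul_mulVec, Pi.smul_apply, Matrix.mulVec_diagonal]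
      change b j + _ = |b j|
      have := (pos j).ne'
      simp only [smul_eq_mul]
      field_simp
      ring
  have hPe : M (P e) = e := by rw [← hrange, hP]
  have hX : ∀ (x : Fin n → ℝ) l, (Xᵀ *ᵥ x) l = (M x).1 l + D l / 2 * (M x).2 l := by
    intro x l
    have := (pos l).ne'
    rw [hM1, hM2, Matrix.smul_mulVec, Matrix.transpose_add, Matrix.transpose_sub,
      Matrix.add_mulVec, Matrix.sub_mulVec, Pi.smul_apply, Pi.add_apply, Pi.sub_apply, smul_eq_mul]
    field_simp
    ring
  have hXt : ∀ (x : Fin n → ℝ) l, (Xtᵀ *ᵥ x) l = (M x).1 l - D l / 2 * (M x).2 l := by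
    intro x l
    have := (pos l).ne'
    rw [hM1, hM2, Matrix.smul_mulVec, Matrix.transpose_add, Matrix.transpose_sub,
      Matrix.add_mulVec, Matrix.sub_mulVec, Pi.smul_apply, Pi.add_apply, Pi.sub_apply, smul_eq_mul]
    field_simp
    ring
  -- Each pair is `ξ l ± (D l / 2) b l`, so flipping the sign of `b l` only swaps its two members.
  have hpairs := pairs z (P e) (fun l => by
    have hz2 : (M z).2 l = b l := hM2 z l
    have he2 : e.2 l = |b l| := rfl
    have he1 : e.1 l = (M z).1 l := rfl
    rw [hX, hXt, hX, hXt, hPe, he1, he2, hz2]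
    rcases abs_choice (b l) with h | h
    · rw [h]
    · rw [h, mul_neg, sub_neg_eq_add, ← sub_eq_add_neg, Sym2.eq_swap]) j
  have hsgn : ∀ x : Fin n → ℝ, Real.sign (((X - Xt)ᵀ *ᵥ x) j) = Real.sign ((M x).2 j) := by
    intro x
    rw [hM2]
    have h0 := inv_pos.2 (pos j)
    rcases lt_trichotomy (((X - Xt)ᵀ *ᵥ x) j) 0 with h | h | h
    · rw [Real.sign_of_neg h, Real.sign_of_neg (mul_neg_of_pos_of_neg h0 h)]
    · rw [h, mul_zero]
    · rw [Real.sign_of_pos h, Real.sign_of_pos (mul_pos h0 h)]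
  have hz2 : (M z).2 j = b j := hM2 z j
  rw [hsgn, hsgn, hPe, hz2, show e.2 j = |b j| from rfl, Real.sign_of_pos (abs_pos.2 (hz j)),
    one_mul] at hpairs
  change W z j = Real.sign (b j) * W (P e) j
  rw [← hpairs, ← mul_assoc]
  rcases lt_or_gt_of_ne (hz j) with h | h
  · rw [Real.sign_of_neg h]; ring
  · rw [Real.sign_of_pos h]; ring

/-! ### Reduction of both formulations to Gaussian signs. -/

variable {Ω : Type*} [MeasurableSpace Ω] {μ : Measure Ω} {X : Matrix (Fin n) (Fin d) ℝ}
  {β : Fin d → ℝ} {σ α : ℝ} {y : Ω → Fin n → ℝ} {Δ : Fin d → ℝ} {βt : Ω → Fin d → ℝ}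
  {R : Ω → Finset (Fin d)}

/-- `signs` counts zero as negative, whereas `Real.sign` does not; this makes the discrepancy a null
event. -/
theorem IsGaussianSplit.ae_ne_zero {ξ b : Ω → Fin d → ℝ} {m : Fin d → ℝ} {v : Fin d → ℝ≥0}
    (h : IsGaussianSplit μ ξ b m v) (hv : ∀ j, v j ≠ 0) : ∀ᵐ ω ∂μ, ∀ j, b ω j ≠ 0 := by
  rw [ae_all_iff]
  intro j
  have := nullSingletonClass_gaussianReal (μ := m j) (hv j)
  rw [(h.law j).ae_iff (p := fun x => x ≠ 0) (measurableSet_setOfPred.1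
    (measurableSet_singleton (0 : ℝ)).compl)]
  exact compl_mem_ae_iff.2 (measure_singleton (0 : ℝ))

/-- In both formulations the whitened estimator has independent Gaussian entries, is independent
of `ξ`, and the rejections are a sequential selection rule applied to its signs. -/
theorem IsKnockoffProcedure.exists_selection [IsProbabilityMeasure μ] (hα : 0 < α)
    (hp : IsKnockoffProcedure μ X σ α y Δ βt R) (h : IsGaussianLinearModel μ X β σ y) :
    (∀ j, 0 < Δ j) ∧
    IsGaussianSplit μ (fun ω => xi X Δ (y ω) (βt ω)) βt β (fun j => (σ ^ 2 * Δ j).toNNReal) ∧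
    ∃ F : (Fin d → ℝ) × (Fin d → ℝ) → (Fin d → Bool) → Finset (Fin d),
      (∀ s, Measurable fun e => ((F e s).card : ℝ)) ∧ (∀ e, IsSequential α (F e)) ∧
      R =ᵐ[μ] fun ω => F (exploratoryData X Δ y βt ω) (signs (βt ω)) := by
  have hσ : 0 < σ ^ 2 := pow_pos h.sigma_pos 2
  cases hp with
  | whitening Δ w A dominates measurable_noise law_noise indep_noise βt whitened R rejections =>
    obtain ⟨hΔ, hsplit⟩ := h.whitening_split dominates measurable_noise law_noise indep_noise
    subst whitened rejections
    refine ⟨hΔ, hsplit, fun e s => seqStep (pValue (signVec s) (A.direction e)) (A.order e) α,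
      fun s => measurable_card_recipe A s α,
      fun e => isSequential_seqStep hα _ (A.direction_eq e) _, ?_⟩
    filter_upwards [hsplit.ae_ne_zero fun j => by
      simpa using mul_pos hσ (hΔ j)] with ω hω
    congr 1
    ext j
    rw [pValue, pValue, sign_signVec, sign_eq_signVec (hω j)]
  | standard Xt D W pos gram cross measurable_stat pairs βt whitened R rejections =>
    have hsplit := h.standard_split pos gram cross
    have hΔ : ∀ j, 0 < 2 / D j := fun j => div_pos two_pos (pos j)
    obtain ⟨g, hg, hWg⟩ := pairs.exists_factorization pos gram cross measurable_stat
    subst whitened rejections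
    refine ⟨hΔ, hsplit, fun e s => knockoffFilter (fun j => signVec s j * g e j) α,
      fun s => ?_, fun e => isSequential_knockoffFilter hα (g e), ?_⟩
    · refine (measurable_card_knockoffFilter α).comp (measurable_pi_lambda _ fun j => ?_)
      exact ((measurable_pi_apply j).comp hg).const_mul _
    filter_upwards [hsplit.ae_ne_zero fun j => by
      simpa using mul_pos hσ (hΔ j)] with ω hω
    congr 1
    ext j
    rw [hWg (y ω) hω j, sign_eq_signVec (b := fun j => (D j)⁻¹ * ((X - Xt)ᵀ *ᵥ y ω) j) (hω j),
      exploratoryData, h.xi_standard Xt pos]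

end

/-! ### The bound on the conditional expected number of rejections -/

section Bound

variable {n d : ℕ} {Ω : Type*} [MeasurableSpace Ω] {μ : Measure Ω} [IsProbabilityMeasure μ]
  {X : Matrix (Fin n) (Fin d) ℝ} {β : Fin d → ℝ} {σ α δ : ℝ} {y : Ω → Fin n → ℝ} {Δ : Fin d → ℝ}
  {βt : Ω → Fin d → ℝ} {R : Ω → Finset (Fin d)}

theorem eta_nonneg (hΔ : ∀ j, 0 < Δ j) (b : Fin d → ℝ) (j : Fin d) : 0 ≤ eta β σ Δ b j := by
  have := hΔ j
  unfold eta
  positivity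

/-- `η j` is the absolute value of the log-odds, so it controls the probability of either sign,
whichever direction the analyst chose. -/
theorem signProb_le (hσ : 0 < σ) (hΔ : ∀ j, 0 < Δ j) (hα : 0 < α) (hδ : 0 < δ) {b : Fin d → ℝ}
    {j : Fin d} (h : eta β σ Δ b j < -Real.log (α + δ)) (t : Bool) :
    signProb (β j) (σ ^ 2 * Δ j).toNNReal t |b j| ≤ 1 - qOf α δ := by
  have hv : 0 < σ ^ 2 * Δ j := mul_pos (pow_pos hσ 2) (hΔ j)
  rw [one_sub_qOf hα hδ, signProb, Real.coe_toNNReal _ hv.le]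
  have habs : |2 * β j * |b j| / (σ ^ 2 * Δ j)| = eta β σ Δ b j := by
    rw [abs_div, abs_mul, abs_mul, abs_abs, abs_two, abs_of_pos hv, eta]
    ring
  have h1 : (if t then (1 : ℝ) else -1) * (2 * β j * |b j| / (σ ^ 2 * Δ j)) ≤
      eta β σ Δ b j := by
    rw [← habs]
    cases t
    · simpa using neg_le_abs _
    · simpa using le_abs_self _
  have h2 : α + δ ≤ Real.exp
      (-((if t then (1 : ℝ) else -1) * (2 * β j * |b j| / (σ ^ 2 * Δ j)))) := by
    rw [← Real.log_le_iff_le_exp (by linarith)]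
    linarith
  exact one_div_le_one_div_of_le (by linarith) (by linarith)

open Classical in
/-- The linear bound, on the event that fewer than `k` log-odds reach `-log (α + δ)`. -/
theorem IsKnockoffProcedure.condExp_le_of_card_lt (hα : 0 < α) (hδ : 0 < δ) (hαδ : α + δ < 1)
    (h : IsGaussianLinearModel μ X β σ y) (hp : IsKnockoffProcedure μ X σ α y Δ βt R) (k : ℕ) :
    ∀ᵐ ω ∂μ, (Finset.univ.filter
        fun j => -Real.log (α + δ) ≤ eta β σ Δ (βt ω) j).card < k →
      (μ[fun ω' => ((R ω').card : ℝ) | exploratorySigma X Δ y βt]) ω ≤ C₁ α δ * k + C₂ α δ := by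
  obtain ⟨hΔ, hsplit, F, hFm, hF, hR⟩ := hp.exists_selection hα h
  have hv : ∀ j, (σ ^ 2 * Δ j).toNNReal ≠ 0 := fun j => by
    simpa using mul_pos (pow_pos h.sigma_pos 2) (hΔ j)
  have hcond := condExp_signs μ _ βt hsplit.measurable_left hsplit.measurable_right β _ hv
    hsplit.law hsplit.indep_entries hsplit.indep (fun e s => ((F e s).card : ℝ)) hFm
    (fun e s => Nat.cast_nonneg _) d (fun e s => by
      exact_mod_cast (Finset.card_le_univ _).trans (Fintype.card_fin d).le)
  have hcongr : μ[fun ω' => ((R ω').card : ℝ) | exploratorySigma X Δ y βt] =ᵐ[μ]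
      μ[fun ω' => ((F (exploratoryData X Δ y βt ω') (signs (βt ω'))).card : ℝ) |
        exploratorySigma X Δ y βt] := by
    refine condExp_congr_ae ?_
    filter_upwards [hR] with ω hω
    rw [hω]
  filter_upwards [hcongr.trans hcond] with ω hω hcard
  rw [hω]
  refine le_trans ?_ (bound_le_explicit hα hδ hαδ (Nat.cast_nonneg k))
  refine (hF _).sum_card_le (p := pOf α) (q := qOf α δ) (lam := lamOf α δ) hα rfl
    (pOf_lt_lamOf hα hδ) (lamOf_lt_qOf hα hδ) (qOf_lt_one hα hδ) (chOf_eq α δ) (chOf_pos hα hδ)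
    (fun j t => signProb (β j) (σ ^ 2 * Δ j).toNNReal t |βt ω j|)
    (fun j t => (signProb_pos _ _ _ _).le) (fun j => signProb_add _ _ _)
    (Finset.univ.filter fun j => -Real.log (α + δ) ≤ eta β σ Δ (βt ω) j)
    (by exact_mod_cast hcard.le) fun j hj t => ?_
  simp only [Finset.mem_filter, Finset.mem_univ, true_and, not_le] at hj
  exact signProb_le h.sigma_pos hΔ hα hδ hj t

theorem IsKnockoffProcedure.condExp_le (hα : 0 < α) (hδ : 0 < δ)
    (h : IsGaussianLinearModel μ X β σ y) (hp : IsKnockoffProcedure μ X σ α y Δ βt R) {k : ℕ}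
    (hk : 1 ≤ k) (hkd : k ≤ d) :
    ∀ᵐ ω ∂μ, kthLargest (eta β σ Δ (βt ω)) k < -Real.log (α + δ) →
      (μ[fun ω' => ((R ω').card : ℝ) | exploratorySigma X Δ y βt]) ω ≤ C₁ α δ * k + C₂ α δ := by
  classical
  by_cases hαδ : α + δ < 1
  · filter_upwards [hp.condExp_le_of_card_lt hα hδ hαδ h k] with ω hω hη
    exact hω (by convert! card_le_of_kthLargest_lt hk hkd hη)
  -- For `α + δ ≥ 1` the event is empty, since log-odds are nonnegative and `-log (α + δ) ≤ 0`.
  · refine ae_of_all _ fun ω hη => absurd hη (not_lt.2 ?_)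
    have h0 := Real.log_nonneg (not_lt.1 hαδ)
    have h1 : 0 ≤ kthLargest (eta β σ Δ (βt ω)) k := by
      rw [kthLargest, dif_pos ⟨hk, hkd⟩]
      exact eta_nonneg (hp.exists_selection hα h).1 _ _
    linarith

/-! ### The true positive rate. -/

theorem bound_nonneg (hα : 0 < α) (hδ : 0 < δ) (hαδ : α + δ < 1) {k : ℝ} (hk : 0 ≤ k) :
    0 ≤ C₁ α δ * k + C₂ α δ := by
  refine le_trans ?_ (bound_le_explicit hα hδ hαδ hk)
  have h1 := pOf_pos hα
  have h2 := pOf_lt_lamOf hα hδ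
  have h3 := chOf_pos hα hδ
  have h4 : 0 ≤ lamOf α δ / (lamOf α δ - pOf α) := div_nonneg (by linarith) (by linarith)
  positivity

/-- The true positive rate is at most the probability that the `k`-th largest log-odds is not
small plus the linear bound divided by the number of non-nulls. -/
theorem IsKnockoffProcedure.tpr_le (hα : 0 < α) (hδ : 0 < δ) (hαδ : α + δ < 1)
    (h : IsGaussianLinearModel μ X β σ y) (hp : IsKnockoffProcedure μ X σ α y Δ βt R) {k : ℕ}
    (hk : 1 ≤ k) (hkd : k ≤ d) :
    tpr μ β R ≤ μ.real {ω | -Real.log (α + δ) ≤ |kthLargest (eta β σ Δ (βt ω)) k|} +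
      (C₁ α δ * k + C₂ α δ) / numNonnull β := by
  classical
  have hcond := hp.condExp_le_of_card_lt hα hδ hαδ h k
  have hK := bound_nonneg hα hδ hαδ (Nat.cast_nonneg (α := ℝ) k)
  obtain ⟨hΔ, hsplit, F, hFm, hF, hR⟩ := hp.exists_selection hα h
  set τ := -Real.log (α + δ) with hτ
  have habs : Measurable fun (b : Fin d → ℝ) j => |b j| :=
    measurable_pi_lambda _ fun j => measurable_norm.comp (measurable_pi_apply j)
  have he : Measurable (exploratoryData X Δ y βt) :=
    hsplit.measurable_left.prodMk (habs.comp hsplit.measurable_right)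
  have hle := he.comap_le
  -- Counting large log-odds gives an event visibly determined by `|βt|`, so the conditional bound
  -- can be integrated over it. The event about the order statistic then enters only through
  -- monotonicity of `μ`.
  set A : Set Ω := {ω | (Finset.univ.filter fun j => τ ≤ eta β σ Δ (βt ω) j).card < k} with hA
  have hAm : MeasurableSet[exploratorySigma X Δ y βt] A := by
    set f : (Fin d → ℝ) × (Fin d → ℝ) → ℕ := fun e =>
      ∑ j, if τ ≤ 2 * e.2 j / (σ ^ 2 * Δ j) * |β j| then 1 else 0 with hf
    have hfm : Measurable f := Finset.measurable_sum _ fun j _ =>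
      Measurable.ite (measurableSet_le measurable_const (by fun_prop)) measurable_const
        measurable_const
    refine ⟨f ⁻¹' Set.Iio k, hfm measurableSet_Iio, ?_⟩
    ext ω
    simp only [hA, hf, exploratoryData, eta, Finset.sum_boole, Nat.cast_id, Set.mem_preimage,
      Set.mem_Iio, Set.mem_ofPred_eq]
    congr!
  have hRm : AEStronglyMeasurable (fun ω => ((R ω).card : ℝ)) μ := by
    have hm := measurable_apply_signs (G := fun e s => ((F e s).card : ℝ))
      hsplit.measurable_right he hFm
    refine hm.aestronglyMeasurable.congr ?_
    filter_upwards [hR] with ω hω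
    rw [hω]
  have hRi : Integrable (fun ω => ((R ω).card : ℝ)) μ :=
    Integrable.of_bound hRm d (ae_of_all _ fun ω => by
      rw [Real.norm_of_nonneg (Nat.cast_nonneg _)]
      exact_mod_cast (Finset.card_le_univ _).trans (Fintype.card_fin d).le)
  have hAm' : MeasurableSet A := hle _ hAm
  have hset : ∫ ω in A, ((R ω).card : ℝ) ∂μ ≤ C₁ α δ * k + C₂ α δ := by
    rw [← setIntegral_condExp hle hRi hAm]
    calc ∫ ω in A, (μ[fun ω' => ((R ω').card : ℝ) | exploratorySigma X Δ y βt]) ω ∂μ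
        ≤ ∫ _ in A, (C₁ α δ * k + C₂ α δ) ∂μ := by
          refine setIntegral_mono_on_ae integrable_condExp.integrableOn
            (integrable_const _).integrableOn hAm' ?_
          filter_upwards [hcond] with ω hω hωA
          exact hω hωA
      _ = μ.real A * (C₁ α δ * k + C₂ α δ) := by
          rw [setIntegral_const, smul_eq_mul]
      _ ≤ C₁ α δ * k + C₂ α δ := mul_le_of_le_one_left hK measureReal_le_one
  have hcompl : μ.real Aᶜ ≤ μ.real {ω | τ ≤ |kthLargest (eta β σ Δ (βt ω)) k|} := by
    refine measureReal_mono fun ω hω => ?_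
    by_contra hcon
    have hcon' : |kthLargest (eta β σ Δ (βt ω)) k| < τ := not_le.1 hcon
    exact hω (card_le_of_kthLargest_lt hk hkd ((le_abs_self _).trans_lt hcon'))
  have hi1 : Integrable (Aᶜ.indicator fun _ => (1 : ℝ)) μ :=
    (integrable_const _).indicator hAm'.compl
  have hi2 : Integrable (fun ω => A.indicator (fun ω => ((R ω).card : ℝ)) ω / numNonnull β) μ :=
    (hRi.indicator hAm').div_const _
  -- Off `A` the proportion of rejected non-nulls is bounded by one; on `A` it is bounded by all
  -- rejections divided by `d₁`.
  calc tpr μ β R ≤ ∫ ω, (Aᶜ.indicator (fun _ => (1 : ℝ)) ω +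
        A.indicator (fun ω => ((R ω).card : ℝ)) ω / numNonnull β) ∂μ := by
        refine integral_mono_of_nonneg (ae_of_all _ fun ω => by positivity) (hi1.add hi2)
          (ae_of_all _ fun ω => ?_)
        by_cases hω : ω ∈ A
        · have : ω ∉ Aᶜ := fun h' => h' hω
          simp only [Set.indicator_of_mem hω, Set.indicator_of_notMem this, zero_add]
          gcongr
          exact Finset.filter_subset _ _
        · have h' : ω ∈ Aᶜ := hω
          simp only [Set.indicator_of_notMem hω, Set.indicator_of_mem h', zero_div, add_zero]
          refine div_le_one_of_le₀ ?_ (Nat.cast_nonneg _)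
          unfold numNonnull
          gcongr
          exact Finset.subset_univ _
    _ = μ.real Aᶜ + (∫ ω in A, ((R ω).card : ℝ) ∂μ) / numNonnull β := by
        rw [integral_add hi1 hi2, integral_div, integral_indicator hAm',
          integral_indicator hAm'.compl, setIntegral_const, smul_eq_mul, mul_one]
    _ ≤ _ := by gcongr

theorem tpr_nonneg (μ : Measure Ω) (β : Fin d → ℝ) (R : Ω → Finset (Fin d)) : 0 ≤ tpr μ β R :=
  integral_nonneg fun ω => by positivity

theorem numNonnull_le (β : Fin d → ℝ) : numNonnull β ≤ d := by
  classical
  exact (Finset.card_le_univ _).trans (Fintype.card_fin d).le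

theorem C₁_pos (hα : 0 < α) : 0 < C₁ α δ := by
  unfold C₁
  have := le_max_left 1 (4 * α * (1 + α + δ) / δ)
  positivity

end Bound

end Knockoff

end

/-! ### The three claims. -/

open Knockoff in
theorem proposition4 :
    -- (a) a linear bound for every `k`, with constants depending on `α` and `δ` only
    (∀ α δ : ℝ, 0 < α → 0 < δ → ∃ c₁ c₂ : ℝ,
      ∀ (n d : ℕ) (Ω : Type*) [MeasurableSpace Ω] (μ : Measure Ω) [IsProbabilityMeasure μ]
        (X : Matrix (Fin n) (Fin d) ℝ) (β : Fin d → ℝ) (σ : ℝ) (y : Ω → Fin n → ℝ)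
        (Δ : Fin d → ℝ) (βt : Ω → Fin d → ℝ) (R : Ω → Finset (Fin d)),
        IsGaussianLinearModel μ X β σ y → IsKnockoffProcedure μ X σ α y Δ βt R →
        ∀ k : ℕ, 1 ≤ k → k ≤ d →
          ∀ᵐ ω ∂μ, kthLargest (eta β σ Δ (βt ω)) k < -Real.log (α + δ) →
            (μ[fun ω' => ((R ω').card : ℝ) | exploratorySigma X Δ y βt]) ω ≤ c₁ * k + c₂) ∧
    -- (b) the explicit constants, for `k ≥ 1 / α`
    (∀ α δ : ℝ, 0 < α → 0 < δ →
      ∀ (n d : ℕ) (Ω : Type*) [MeasurableSpace Ω] (μ : Measure Ω) [IsProbabilityMeasure μ]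
        (X : Matrix (Fin n) (Fin d) ℝ) (β : Fin d → ℝ) (σ : ℝ) (y : Ω → Fin n → ℝ)
        (Δ : Fin d → ℝ) (βt : Ω → Fin d → ℝ) (R : Ω → Finset (Fin d)),
        IsGaussianLinearModel μ X β σ y → IsKnockoffProcedure μ X σ α y Δ βt R →
        ∀ k : ℕ, 1 / α ≤ (k : ℝ) → k ≤ d →
          ∀ᵐ ω ∂μ, kthLargest (eta β σ Δ (βt ω)) k < -Real.log (α + δ) →
            (μ[fun ω' => ((R ω').card : ℝ) | exploratorySigma X Δ y βt]) ω
              ≤ C₁ α δ * k + C₂ α δ) ∧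
    -- (c) vanishing power
    (∀ α : ℝ, 0 < α → α < 1 →
      ∀ (n d : ℕ → ℕ) (Ω : ℕ → Type*) [∀ i, MeasurableSpace (Ω i)]
        (μ : ∀ i, Measure (Ω i)) [∀ i, IsProbabilityMeasure (μ i)]
        (X : ∀ i, Matrix (Fin (n i)) (Fin (d i)) ℝ) (β : ∀ i, Fin (d i) → ℝ) (σ : ℕ → ℝ)
        (y : ∀ i, Ω i → Fin (n i) → ℝ) (Δ : ∀ i, Fin (d i) → ℝ)
        (βt : ∀ i, Ω i → Fin (d i) → ℝ) (R : ∀ i, Ω i → Finset (Fin (d i))),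
        (∀ i, IsGaussianLinearModel (μ i) (X i) (β i) (σ i) (y i)) →
        (∀ i, IsKnockoffProcedure (μ i) (X i) (σ i) α (y i) (Δ i) (βt i) (R i)) →
        Tendsto (fun i => numNonnull (β i)) atTop atTop →
        (∀ c : ℝ, 0 < c → ∀ ε : ℝ, 0 < ε →
          Tendsto (fun i => μ i {ω | ε ≤
              |kthLargest (eta (β i) (σ i) (Δ i) (βt i ω)) ⌈c * (numNonnull (β i) : ℝ)⌉₊|})
            atTop (𝓝 0)) →
        Tendsto (fun i => tpr (μ i) (β i) (R i)) atTop (𝓝 0)) := by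
  refine ⟨fun α δ hα hδ => ⟨C₁ α δ, C₂ α δ, ?_⟩, ?_, ?_⟩
  · intro n d Ω _ μ _ X β σ y Δ βt R h hp k hk hkd
    exact hp.condExp_le hα hδ h hk hkd
  · intro α δ hα hδ n d Ω _ μ _ X β σ y Δ βt R h hp k hk hkd
    have hk0 : (0 : ℝ) < k := (one_div_pos.2 hα).trans_le hk
    exact hp.condExp_le hα hδ h (Nat.cast_pos.1 hk0) hkd
  · intro α hα hα1 n d Ω _ μ _ X β σ y Δ βt R h hp hd1 hη
    -- Any `δ` with `α + δ < 1` would do: the threshold `-log (α + δ)` is then a fixed positive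
    -- number.
    set δ := (1 - α) / 2 with hδdef
    have hδ : 0 < δ := by linarith
    have hαδ : α + δ < 1 := by linarith
    have hτ : 0 < -Real.log (α + δ) := neg_pos.2 (Real.log_neg (by linarith) hαδ)
    have hC : 0 < C₁ α δ := C₁_pos hα
    refine tendsto_order.2 ⟨fun a ha => Eventually.of_forall fun i =>
      ha.trans_le (tpr_nonneg _ _ _), fun ε hε => ?_⟩
    -- The second entry makes the limiting bound `C₁ c` at most `ε / 2`; the first keeps the ceiling
    -- of `c d₁` within `d₁ ≤ d`.
    set c := min 1 (ε / (2 * C₁ α δ)) with hc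
    have hc0 : 0 < c := lt_min one_pos (by positivity)
    have hc1 : c ≤ 1 := min_le_left _ _
    have hcε : C₁ α δ * c < ε := by
      have h1 : C₁ α δ * c ≤ C₁ α δ * (ε / (2 * C₁ α δ)) :=
        mul_le_mul_of_nonneg_left (min_le_right _ _) hC.le
      have h2 : C₁ α δ * (ε / (2 * C₁ α δ)) = ε / 2 := by field_simp
      linarith
    have hprob := hη c hc0 _ hτ
    have hprob' := (ENNReal.tendsto_toReal ENNReal.zero_ne_top).comp hprob
    -- The extra `C₁` pays for rounding `c d₁` up to an integer.
    have hd1' : Tendsto (fun i => (C₁ α δ + C₂ α δ) / (numNonnull (β i) : ℝ)) atTop (𝓝 0) :=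
      (tendsto_natCast_atTop_atTop.comp hd1).const_div_atTop _
    have hsum := (hprob'.add (tendsto_const_nhds (x := C₁ α δ * c))).add hd1'
    rw [ENNReal.toReal_zero, zero_add, add_zero] at hsum
    filter_upwards [hsum.eventually (gt_mem_nhds hcε), hd1.eventually_ge_atTop 1] with i hi hi1
    refine lt_of_le_of_lt ?_ hi
    have hN : (0 : ℝ) < numNonnull (β i) := by exact_mod_cast hi1
    have hk : 1 ≤ ⌈c * (numNonnull (β i) : ℝ)⌉₊ := Nat.one_le_ceil_iff.2 (by positivity)
    have hkd : ⌈c * (numNonnull (β i) : ℝ)⌉₊ ≤ d i :=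
      (Nat.ceil_le.2 (mul_le_of_le_one_left hN.le hc1)).trans (numNonnull_le _)
    refine ((hp i).tpr_le hα hδ hαδ (h i) hk hkd).trans ?_
    rw [add_assoc]
    refine add_le_add le_rfl ?_
    rw [div_le_iff₀ hN, add_mul, div_mul_cancel₀ _ hN.ne']
    have hceil := (Nat.ceil_lt_add_one (show 0 ≤ c * (numNonnull (β i) : ℝ) by positivity)).le
    have := mul_le_mul_of_nonneg_left hceil hC.le
    linarith
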